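/- Let $n\in\{1,2,\dots,\infty\}$, and let $\mathcal{TO}_n$ be the Toeplitz--Cuntz algebra, i.e. the universal unital $C^*$-algebra generated by isometries $v_i$ ($1\le i\le n$, $i<\infty$) with mutually orthogonal ranges, $v_j^*v_i=\delta_{ij}1$; for $n=\infty$ this is the Cuntz algebra $\mathcal O_\infty$. Let $\mathcal W$ be the set of all multi-indices $\mu=(i_1,\dots,i_k)$, $k\ge 0$, and put $|\mu|=k$, $v_\mu=v_{i_1}\cdots v_{i_k}$, $v_\emptyset=1$. The closed linear span $\mathcal E_k\subseteq\mathcal{TO}_n$ of $\{v_\mu:|\mu|=k\}$ is a Hilbert space with inner product $\langle f,g\rangle 1=g^*f$ and orthonormal basis $\{v_\mu:|\mu|=k\}$. Let $\mathcal E=\mathcal E_1$ and let $F_{\mathcal E}=\bigoplus_{k\ge0}\mathcal E_k$ be the full Fock space over $\mathcal E$, i.e. the Hilbert space with orthonormal basis $\{v_\mu:\mu\in\mathcal W\}$. Let $r(v_i)$ be the isometry of $F_{\mathcal E}$ with $r(v_i)v_\mu=v_\mu v_i$, let $$\beta(A)=\sum_{i=1}^n r(v_i)A\,r(v_i)^*\qquad(A\in\mathcal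 B(F_{\mathcal E})),$$ the series converging in the strong operator topology, let $P_k$ be the orthogonal projection onto $\bigoplus_{j\le k}\mathcal E_j$, let $\mathfrak B_k=\{T\in\mathcal B(F_{\mathcal E}):T=P_kTP_k\}$, and let $\mathfrak B=\bigcup_{k\ge0}\mathfrak B_k$ be the $*$-algebra of operators with bounded support, which $\beta$ maps into itself. Write $|f\rangle\langle g|$ for the operator $h\mapsto\langle h,g\rangle f$. A linear functional $\omega:\mathfrak B\to\mathbb C$ is called positive if $\omega(B^*B)\ge0$ for all $B\in\mathfrak B$, decreasing if $\omega(B^*B)-\omega(\beta(B^*B))\ge0$ for all $B\in\mathfrak B$, and locally normal if its restriction to each von Neumann algebra $\mathfrak B_k$ is normal ($\sigma$-weakly continuous). Let $\mathcal P_\beta$ be the cone of decreasing positive linear functionals on $\mathfrak B$, let $\mathcal W_\beta\subseteq\mathcal P_\beta$ be the subcone of those that are locally normal, and order both by $\omega_1\le\omega_2\iff\omega_2-\omega_1\in\mathcal P_\beta$. **Theorem.** For each $\omega\in\mathcal W_\beta$ there is a unique positive linear functional $\rho$ on $\mathcal{TO}_n$ which satisfies $$\rho(v_\mu v_\nu^*)=\omega(|v_\mu\rangle\langle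 v_\nu|),\qquad \mu,\nu\in\mathcal W.$$ Moreover, the map $\omega\mapsto\rho$ is an affine order isomorphism of $\mathcal W_\beta$ onto the positive part of the dual of $\mathcal{TO}_n$: it is a bijection that is additive and homogeneous for nonnegative real scalars, and $\omega_1\le\omega_2$ if and only if $\rho_2-\rho_1$ is positive, where $\rho_1,\rho_2$ are the images of $\omega_1,\omega_2$. -/

import Mathlib

open scoped ENNReal ComplexOrder InnerProductSpace NNReal

/-! ### The Toeplitz-Cuntz algebra as a universal C*-algebra -/

/-- The defining relations of the Toeplitz-Cuntz algebra: the `w i` are isometries with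
mutually orthogonal ranges. -/
def IsToeplitzCuntzFamily {ι : Type} {A : Type*} [Semiring A] [StarRing A] (w : ι → A) : Prop :=
  (∀ i, star (w i) * w i = 1) ∧ ∀ i j, i ≠ j → star (w j) * w i = 0

/-- A family of isometries with mutually orthogonal ranges in some nonzero unital C*-algebra. -/
structure ToeplitzCuntzRep (ι : Type) : Type 1 where
  carrier : Type
  [cstar : CStarAlgebra carrier]
  [nontriv : Nontrivial carrier]
  gen : ι → carrier
  rel : IsToeplitzCuntzFamily gen

attribute [instance] ToeplitzCuntzRep.cstar ToeplitzCuntzRep.nontriv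

/-- The product (bounded families) of all C*-algebras carrying such a family. -/
abbrev ToeplitzCuntzProduct (ι : Type) : Type 1 :=
  lp (fun R : ToeplitzCuntzRep ι => R.carrier) ∞

noncomputable instance (ι : Type) : CStarAlgebra (ToeplitzCuntzProduct ι) where
  toNormedRing := lp.inftyNormedRing
  toStarRing := lp.inftyStarRing
  toCStarRing := lp.inftyCStarRing
  toNormedAlgebra := lp.inftyNormedAlgebra
  toStarModule := inferInstance
  toCompleteSpace := inferInstance

theorem ToeplitzCuntzRep.norm_gen_le {ι : Type} (R : ToeplitzCuntzRep ι) (i : ι) :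
    ‖R.gen i‖ ≤ 1 := by
  have h : ‖R.gen i‖ * ‖R.gen i‖ = 1 := by
    rw [← CStarRing.norm_star_mul_self, R.rel.1 i, norm_one]
  nlinarith [norm_nonneg (R.gen i)]

/-- The universal family, as an element of the product. -/
noncomputable def ToeplitzCuntzProduct.gen {ι : Type} (i : ι) : ToeplitzCuntzProduct ι :=
  ⟨fun R => R.gen i, ⟨1, by rintro _ ⟨R, rfl⟩; exact R.norm_gen_le i⟩⟩

/-- The C*-algebra generated by the universal family. -/
noncomputable def toeplitzCuntzSubalgebra (ι : Type) : StarSubalgebra ℂ (ToeplitzCuntzProduct ι) :=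
  (StarAlgebra.adjoin ℂ (Set.range (ToeplitzCuntzProduct.gen (ι := ι)))).topologicalClosure

instance (ι : Type) : IsClosed (toeplitzCuntzSubalgebra ι : Set (ToeplitzCuntzProduct ι)) :=
  StarSubalgebra.isClosed_topologicalClosure _

/-- The Toeplitz-Cuntz algebra: the universal unital C*-algebra generated by isometries
`(v_i)_{i : ι}` with mutually orthogonal ranges, obtained as the closed *-algebra generated by the
universal family inside the product of all C*-algebras carrying such a family. For infinite `ι` this
is the Cuntz algebra `𝒪_∞`. (A C*-algebra generated by countably many elements has at most the
cardinality of the continuum, so nothing is lost by taking the competing algebras in `Type`.) -/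
def ToeplitzCuntz (ι : Type) : Type 1 := toeplitzCuntzSubalgebra ι

namespace ToeplitzCuntz

noncomputable instance (ι : Type) : CStarAlgebra (ToeplitzCuntz ι) :=
  inferInstanceAs (CStarAlgebra (toeplitzCuntzSubalgebra ι))

/-- The distinguished generating isometries `v_i`. -/
noncomputable def gen {ι : Type} (i : ι) : ToeplitzCuntz ι :=
  (⟨ToeplitzCuntzProduct.gen i, StarSubalgebra.le_topologicalClosure _
    (StarAlgebra.subset_adjoin ℂ _ ⟨i, rfl⟩)⟩ : toeplitzCuntzSubalgebra ι)

theorem isToeplitzCuntzFamily_gen (ι : Type) :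
    IsToeplitzCuntzFamily (gen : ι → ToeplitzCuntz ι) := by
  refine ⟨fun i => Subtype.ext (lp.ext (funext fun R => R.rel.1 i)),
    fun i j h => Subtype.ext (lp.ext (funext fun R => R.rel.2 i j h))⟩

theorem dense_adjoin_gen (ι : Type) :
    (StarAlgebra.adjoin ℂ (Set.range (gen : ι → ToeplitzCuntz ι))).topologicalClosure = ⊤ := by
  let φ : ToeplitzCuntz ι →⋆ₐ[ℂ] ToeplitzCuntzProduct ι := (toeplitzCuntzSubalgebra ι).subtype
  have hφ : Topology.IsInducing φ := Topology.IsInducing.subtypeVal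
  have himg : (StarAlgebra.adjoin ℂ (Set.range (gen : ι → ToeplitzCuntz ι))).map φ =
      StarAlgebra.adjoin ℂ (Set.range ToeplitzCuntzProduct.gen) := by
    rw [StarAlgHom.map_adjoin, ← Set.range_comp]; rfl
  refine eq_top_iff.2 fun x _ => ?_
  rw [← SetLike.mem_coe, StarSubalgebra.topologicalClosure_coe, hφ.closure_eq_preimage_closure_image,
    Set.mem_preimage, ← StarSubalgebra.coe_map, himg, ← StarSubalgebra.topologicalClosure_coe]
  exact Subtype.property (p := (· ∈ toeplitzCuntzSubalgebra ι)) x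

/-- Evaluation of the universal family at a given one. -/
noncomputable def eval {ι : Type} (R : ToeplitzCuntzRep ι) : ToeplitzCuntz ι →⋆ₐ[ℂ] R.carrier where
  toFun x := (x : toeplitzCuntzSubalgebra ι).1 R
  map_one' := rfl
  map_mul' _ _ := rfl
  map_zero' := rfl
  map_add' _ _ := rfl
  commutes' _ := rfl
  map_star' _ := rfl

theorem exists_lift {ι B : Type} [CStarAlgebra B] [Nontrivial B] (w : ι → B)
    (hw : IsToeplitzCuntzFamily w) : ∃ φ : ToeplitzCuntz ι →⋆ₐ[ℂ] B, ∀ i, φ (gen i) = w i :=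
  ⟨eval ⟨B, w, hw⟩, fun _ => rfl⟩

/-- The product `v_μ = v_{i₁} ⋯ v_{i_k}` for a multi-index `μ = (i₁, …, i_k)`; `v_∅ = 1`. -/
noncomputable def word {ι : Type} (μ : List ι) : ToeplitzCuntz ι := (μ.map gen).prod

/-- For words of equal length, `v_ν⋆ v_μ = δ_{μν} 1`: the `v_μ` with `|μ| = k` are orthonormal for the
inner product `⟨f, g⟩ 1 = g⋆ f` on their closed linear span `ℰ_k` in the Toeplitz-Cuntz algebra. -/
theorem star_word_mul_word {ι : Type} [DecidableEq ι] (μ ν : List ι) (h : μ.length = ν.length) :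
    star (word ν) * word μ = if μ = ν then 1 else 0 := by
  induction μ generalizing ν with
  | nil =>
    obtain rfl : ν = [] := List.length_eq_zero_iff.1 h.symm
    simp [word]
  | cons i μ ih =>
    obtain _ | ⟨j, ν⟩ := ν
    · simp at h
    have ih' := ih ν (by simpa using h)
    have e : star (word (j :: ν)) * word (i :: μ) =
        star (word ν) * (star (gen j) * gen i) * word μ := by
      simp [word, mul_assoc]
    rw [e]
    by_cases hij : i = j
    · subst hij
      rw [(isToeplitzCuntzFamily_gen ι).1 i, mul_one, ih']
      simp
    · rw [(isToeplitzCuntzFamily_gen ι).2 i j hij, mul_zero, zero_mul, if_neg (by simp [hij])]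

end ToeplitzCuntz

/-! ### Fock space and the operators of bounded support -/

/-- The full Fock space `⨁ₖ ℰ_k` over the Hilbert space `ℰ` with orthonormal basis `(v_i)_{i : ι}`,
realised as the Hilbert space with orthonormal basis `(v_μ)` indexed by all finite words `μ` in the
index set; the words of length `k` are an orthonormal basis of `ℰ_k`. -/
abbrev FockSpace (ι : Type) : Type := lp (fun _ : List ι => ℂ) 2

namespace FockSpace
open Classical in
/-- The vector `v_μ` of Fock space. -/
noncomputable def basisVec {ι : Type} (μ : List ι) : FockSpace ι := lp.single 2 μ 1

theorem basisVec_apply {ι : Type} (μ ν : List ι) [Decidable (ν = μ)] :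
    (basisVec μ : FockSpace ι) ν = if ν = μ then 1 else 0 := by
  classical
  rw [basisVec, lp.single_apply, Pi.single_apply]
  congr

theorem inner_basisVec {ι : Type} (μ : List ι) (x : FockSpace ι) :
    ⟪basisVec μ, x⟫_ℂ = x μ := by
  classical
  rw [basisVec, lp.inner_single_left]; simp

theorem orthonormal_basisVec (ι : Type) : Orthonormal ℂ (basisVec : List ι → FockSpace ι) := by
  classical
  rw [orthonormal_iff_ite]
  intro μ ν
  rw [inner_basisVec, basisVec_apply]

theorem orthonormal_basisVec_append {ι : Type} (i : ι) :
    Orthonormal ℂ (fun μ : List ι => (basisVec (μ ++ [i]) : FockSpace ι)) :=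
  (orthonormal_basisVec ι).comp _ (List.append_left_injective [i])

/-- Right multiplication by `v_i` on Fock space: the isometry `v_μ ↦ v_μ v_i`. -/
noncomputable def rightCreation {ι : Type} (i : ι) : FockSpace ι →ₗᵢ[ℂ] FockSpace ι :=
  (orthonormal_basisVec_append i).orthogonalFamily.linearIsometry

theorem hasSum_rightCreation {ι : Type} (i : ι) (x : FockSpace ι) :
    HasSum (fun μ => x μ • (basisVec (μ ++ [i]) : FockSpace ι)) (rightCreation i x) :=
  (orthonormal_basisVec_append i).orthogonalFamily.hasSum_linearIsometry x

theorem rightCreation_basisVec {ι : Type} (i : ι) (μ : List ι) :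
    rightCreation i (basisVec μ) = basisVec (μ ++ [i]) := by
  classical
  have h := (orthonormal_basisVec_append i).orthogonalFamily.linearIsometry_apply_single
    (i := μ) (1 : ℂ)
  rw [LinearIsometry.toSpanSingleton_apply, one_smul] at h
  rw [← h, basisVec]
  rfl

theorem orthogonalFamily_rightCreation (ι : Type) :
    OrthogonalFamily ℂ (fun _ : ι => FockSpace ι) rightCreation := by
  intro i j hij x y
  have hx := hasSum_rightCreation i x
  have hy := hasSum_rightCreation j y
  have h1 : ∀ μ, ⟪(basisVec (μ ++ [i]) : FockSpace ι), rightCreation j y⟫_ℂ = 0 := by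
    intro μ
    refine (hy.mapL (innerSL ℂ (basisVec (μ ++ [i]) : FockSpace ι))).unique ?_
    convert hasSum_zero with ν
    simp only [innerSL_apply_apply, inner_smul_right]
    rw [(orthonormal_basisVec ι).inner_eq_zero, mul_zero]
    intro h
    exact hij (by simpa using congrArg List.getLast? h)
  have h2 := (hx.mapL (innerSL ℂ (rightCreation j y)))
  have h3 : ⟪rightCreation j y, rightCreation i x⟫_ℂ = 0 := by
    refine h2.unique ?_
    convert hasSum_zero with μ
    simp only [innerSL_apply_apply, inner_smul_right]
    rw [← inner_conj_symm, h1, map_zero, mul_zero]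
  rw [← inner_conj_symm, h3, map_zero]

open ContinuousLinearMap in
theorem sum_norm_adjoint_sq_le {ι : Type} (s : Finset ι) (x : FockSpace ι) :
    ∑ i ∈ s, ‖adjoint (rightCreation i).toContinuousLinearMap x‖ ^ 2 ≤ ‖x‖ ^ 2 := by
  classical
  set a : ι → FockSpace ι := fun i => adjoint (rightCreation i).toContinuousLinearMap x with ha
  set y : FockSpace ι := ∑ i ∈ s, rightCreation i (a i) with hy
  have h1 : ‖y‖ ^ 2 = ∑ i ∈ s, ‖a i‖ ^ 2 :=
    (orthogonalFamily_rightCreation ι).norm_sum a s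
  have h2 : ⟪y, x⟫_ℂ = ((∑ i ∈ s, ‖a i‖ ^ 2 : ℝ) : ℂ) := by
    rw [hy, sum_inner]
    push_cast
    refine Finset.sum_congr rfl fun i _ => ?_
    have := adjoint_inner_right (rightCreation i).toContinuousLinearMap (a i) x
    rw [LinearIsometry.coe_toContinuousLinearMap] at this
    rw [← this]
    exact inner_self_eq_norm_sq_to_K _
  have h3 : ‖y‖ ^ 2 ≤ ‖y‖ * ‖x‖ := by
    have := norm_inner_le_norm (𝕜 := ℂ) y x
    rw [h2, ← h1] at this
    simpa using this
  rw [← h1]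
  have : ‖y‖ ≤ ‖x‖ := by
    by_contra hlt
    push Not at hlt
    nlinarith [norm_nonneg x]
  gcongr

open ContinuousLinearMap in
theorem sum_norm_shift_sq_le {ι : Type} (A : FockSpace ι →L[ℂ] FockSpace ι) (x : FockSpace ι)
    (s : Finset ι) :
    ∑ i ∈ s, ‖A (adjoint (rightCreation i).toContinuousLinearMap x)‖ ^ 2 ≤
      ‖A‖ ^ 2 * ‖x‖ ^ 2 := by
  calc _ ≤ ∑ i ∈ s, ‖A‖ ^ 2 * ‖adjoint (rightCreation i).toContinuousLinearMap x‖ ^ 2 := by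
        gcongr with i
        rw [← mul_pow]
        gcongr
        exact A.le_opNorm _
    _ ≤ _ := by
        rw [← Finset.mul_sum]
        gcongr
        exact sum_norm_adjoint_sq_le s x

open ContinuousLinearMap in
theorem summable_shift {ι : Type} (A : FockSpace ι →L[ℂ] FockSpace ι) (x : FockSpace ι) :
    Summable fun i => rightCreation i (A (adjoint (rightCreation i).toContinuousLinearMap x)) := by
  rw [(orthogonalFamily_rightCreation ι).summable_iff_norm_sq_summable]
  exact summable_of_sum_le (fun _ => by positivity) (sum_norm_shift_sq_le A x)

open ContinuousLinearMap in
theorem norm_tsum_shift_le {ι : Type} (A : FockSpace ι →L[ℂ] FockSpace ι) (x : FockSpace ι) :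
    ‖∑' i, rightCreation i (A (adjoint (rightCreation i).toContinuousLinearMap x))‖ ≤
      ‖A‖ * ‖x‖ := by
  refine le_of_tendsto (summable_shift A x).hasSum.norm (Filter.Eventually.of_forall fun s => ?_)
  refine (sq_le_sq₀ (norm_nonneg _) (by positivity)).1 ?_
  rw [(orthogonalFamily_rightCreation ι).norm_sum, mul_pow]
  exact sum_norm_shift_sq_le A x s

open ContinuousLinearMap in
/-- `β(A) = ∑ᵢ r(vᵢ) A r(vᵢ)⋆`, the series converging in the strong operator topology. -/
noncomputable def shift {ι : Type} (A : FockSpace ι →L[ℂ] FockSpace ι) :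
    FockSpace ι →L[ℂ] FockSpace ι :=
  LinearMap.mkContinuous
    { toFun := fun x =>
        ∑' i, rightCreation i (A (adjoint (rightCreation i).toContinuousLinearMap x))
      map_add' := fun x y => by
        simp only [map_add]
        exact (summable_shift A x).tsum_add (summable_shift A y)
      map_smul' := fun c x => by
        simp only [map_smul, RingHom.id_apply]
        exact (summable_shift A x).tsum_const_smul c }
    ‖A‖ (norm_tsum_shift_le A)

open ContinuousLinearMap in
theorem hasSum_shift {ι : Type} (A : FockSpace ι →L[ℂ] FockSpace ι) (x : FockSpace ι) :
    HasSum (fun i => rightCreation i (A (adjoint (rightCreation i).toContinuousLinearMap x)))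
      (shift A x) :=
  (summable_shift A x).hasSum

theorem shift_add {ι : Type} (A B : FockSpace ι →L[ℂ] FockSpace ι) :
    shift (A + B) = shift A + shift B := by
  ext1 x
  refine (hasSum_shift _ x).unique ?_
  simpa using (hasSum_shift A x).add (hasSum_shift B x)

theorem shift_smul {ι : Type} (c : ℂ) (A : FockSpace ι →L[ℂ] FockSpace ι) :
    shift (c • A) = c • shift A := by
  ext1 x
  refine (hasSum_shift _ x).unique ?_
  simpa using (hasSum_shift A x).const_smul c

/-- The closed linear span of the words of length at most `k`, i.e. `⨁_{j ≤ k} ℰ_j`. -/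
noncomputable def upTo (ι : Type) (k : ℕ) : Submodule ℂ (FockSpace ι) :=
  (Submodule.span ℂ {x | ∃ μ : List ι, μ.length ≤ k ∧ x = basisVec μ}).topologicalClosure

instance (ι : Type) (k : ℕ) : CompleteSpace (upTo ι k) :=
  (Submodule.isClosed_topologicalClosure _).completeSpace_coe

/-- The orthogonal projection `P_k` onto `⨁_{j ≤ k} ℰ_j`. -/
noncomputable def proj (ι : Type) (k : ℕ) : FockSpace ι →L[ℂ] FockSpace ι :=
  (upTo ι k).starProjection

theorem upTo_mono (ι : Type) {j k : ℕ} (h : j ≤ k) : upTo ι j ≤ upTo ι k :=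
  Submodule.topologicalClosure_mono (Submodule.span_mono fun _ ⟨μ, hμ, hx⟩ => ⟨μ, hμ.trans h, hx⟩)

theorem basisVec_mem_upTo {ι : Type} {k : ℕ} {μ : List ι} (h : μ.length ≤ k) :
    basisVec μ ∈ upTo ι k :=
  Submodule.le_topologicalClosure _ (Submodule.subset_span ⟨μ, h, rfl⟩)

theorem proj_basisVec_of_le {ι : Type} {k : ℕ} {μ : List ι} (h : μ.length ≤ k) :
    proj ι k (basisVec μ) = basisVec μ :=
  Submodule.starProjection_eq_self_iff.2 (basisVec_mem_upTo h)

theorem proj_basisVec_of_lt {ι : Type} {k : ℕ} {μ : List ι} (h : k < μ.length) :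
    proj ι k (basisVec μ) = 0 := by
  refine (upTo ι k).starProjection_apply_eq_zero_iff.2 ?_
  rw [upTo, Submodule.orthogonal_closure, Submodule.mem_orthogonal]
  intro x hx
  induction hx using Submodule.span_induction with
  | mem x hx =>
    obtain ⟨ν, hν, rfl⟩ := hx
    exact (orthonormal_basisVec ι).inner_eq_zero (by rintro rfl; omega)
  | zero => exact inner_zero_left _
  | add x y _ _ hx hy => rw [inner_add_left, hx, hy, add_zero]
  | smul c x _ hx => rw [inner_smul_left, hx, mul_zero]

theorem ext_basisVec {ι : Type} {S T : FockSpace ι →L[ℂ] FockSpace ι}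
    (h : ∀ μ, S (basisVec μ) = T (basisVec μ)) : S = T := by
  classical
  ext1 x
  have hx : HasSum (fun μ => x μ • (basisVec μ : FockSpace ι)) x := by
    convert lp.hasSum_single (p := 2) (by norm_num) x using 2 with μ
    rw [basisVec, ← lp.single_smul, smul_eq_mul, mul_one]
  refine (hx.mapL S).unique ?_
  convert hx.mapL T using 2 with μ
  simp only [map_smul, h]

theorem proj_idem (ι : Type) (k : ℕ) : proj ι k * proj ι k = proj ι k :=
  (upTo ι k).isIdempotentElem_starProjection

theorem star_proj (ι : Type) (k : ℕ) : star (proj ι k) = proj ι k :=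
  isSelfAdjoint_starProjection (upTo ι k)

theorem proj_mul_proj (ι : Type) {j k : ℕ} (h : j ≤ k) : proj ι k * proj ι j = proj ι j := by
  ext1 x
  exact Submodule.starProjection_eq_self_iff.2
    (upTo_mono ι h (Submodule.starProjection_apply_mem _ _))

theorem proj_mul_proj' (ι : Type) {j k : ℕ} (h : j ≤ k) : proj ι j * proj ι k = proj ι j := by
  have := congrArg star (proj_mul_proj ι h)
  rwa [star_mul, star_proj, star_proj] at this

/-- The von Neumann algebra `𝔅_k` of all operators `T = P_k T P_k`. -/
noncomputable def supportedUpTo (ι : Type) (k : ℕ) :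
    NonUnitalStarSubalgebra ℂ (FockSpace ι →L[ℂ] FockSpace ι) where
  carrier := {T | proj ι k * T * proj ι k = T}
  add_mem' {S T} hS hT := by
    simp only [Set.mem_ofPred_eq] at *
    rw [mul_add, add_mul, hS, hT]
  zero_mem' := by simp
  mul_mem' {S T} hS hT := by
    simp only [Set.mem_ofPred_eq] at *
    have h1 : proj ι k * S = S := by rw [← hS]; simp only [← mul_assoc, proj_idem]
    have h2 : T * proj ι k = T := by rw [← hT]; simp only [mul_assoc, proj_idem]
    rw [← mul_assoc, h1, mul_assoc, h2]
  smul_mem' c T hT := by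
    simp only [Set.mem_ofPred_eq] at *
    rw [mul_smul_comm, smul_mul_assoc, hT]
  star_mem' {T} hT := by
    simp only [Set.mem_ofPred_eq] at *
    conv_rhs => rw [← hT]
    rw [star_mul, star_mul, star_proj, mul_assoc]

theorem mem_supportedUpTo {ι : Type} {k : ℕ} {T : FockSpace ι →L[ℂ] FockSpace ι} :
    T ∈ supportedUpTo ι k ↔ proj ι k * T * proj ι k = T := Iff.rfl

theorem supportedUpTo_mono (ι : Type) {j k : ℕ} (h : j ≤ k) :
    supportedUpTo ι j ≤ supportedUpTo ι k := by
  intro T hT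
  rw [mem_supportedUpTo] at *
  rw [← hT]
  simp only [← mul_assoc, proj_mul_proj ι h]
  simp only [mul_assoc, proj_mul_proj' ι h]

/-- The algebra `𝔅 = ⋃ₖ 𝔅_k` of operators on Fock space which have bounded support. -/
noncomputable def boundedSupport (ι : Type) :
    NonUnitalStarSubalgebra ℂ (FockSpace ι →L[ℂ] FockSpace ι) where
  carrier := {T | ∃ k, T ∈ supportedUpTo ι k}
  add_mem' := fun ⟨j, hj⟩ ⟨k, hk⟩ => ⟨max j k,
    add_mem (supportedUpTo_mono ι (le_max_left j k) hj) (supportedUpTo_mono ι (le_max_right j k) hk)⟩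
  zero_mem' := ⟨0, zero_mem _⟩
  mul_mem' := fun ⟨j, hj⟩ ⟨k, hk⟩ => ⟨max j k,
    mul_mem (supportedUpTo_mono ι (le_max_left j k) hj) (supportedUpTo_mono ι (le_max_right j k) hk)⟩
  smul_mem' c _ := fun ⟨k, hk⟩ => ⟨k, SMulMemClass.smul_mem c hk⟩
  star_mem' := fun ⟨k, hk⟩ => ⟨k, star_mem hk⟩

theorem proj_succ_rightCreation {ι : Type} (k : ℕ) (i : ι) (x : FockSpace ι) :
    proj ι (k + 1) (rightCreation i x) = rightCreation i (proj ι k x) := by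
  have h : proj ι (k + 1) * (rightCreation i).toContinuousLinearMap =
      (rightCreation i).toContinuousLinearMap * proj ι k := by
    refine ext_basisVec fun μ => ?_
    change proj ι (k + 1) (rightCreation i (basisVec μ)) = rightCreation i (proj ι k (basisVec μ))
    rw [rightCreation_basisVec]
    by_cases hμ : μ.length ≤ k
    · rw [proj_basisVec_of_le hμ, proj_basisVec_of_le (by simpa using hμ), rightCreation_basisVec]
    · push Not at hμ
      rw [proj_basisVec_of_lt hμ, proj_basisVec_of_lt (by simpa using hμ), map_zero]
  exact DFunLike.congr_fun h x

open ContinuousLinearMap in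
theorem shift_mem {ι : Type} {k : ℕ} {T : FockSpace ι →L[ℂ] FockSpace ι}
    (hT : T ∈ supportedUpTo ι k) : shift T ∈ supportedUpTo ι (k + 1) := by
  have hadj : ∀ (i : ι) (x : FockSpace ι),
      adjoint (rightCreation i).toContinuousLinearMap (proj ι (k + 1) x) =
        proj ι k (adjoint (rightCreation i).toContinuousLinearMap x) := by
    intro i x
    have h : proj ι (k + 1) * (rightCreation i).toContinuousLinearMap =
        (rightCreation i).toContinuousLinearMap * proj ι k := by
      ext1 y; exact proj_succ_rightCreation k i y
    have h' := congrArg star h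
    rw [star_mul, star_mul, star_proj, star_proj] at h'
    exact DFunLike.congr_fun h' x
  rw [mem_supportedUpTo] at *
  ext1 x
  refine HasSum.unique ?_ (hasSum_shift T x)
  have hs := (hasSum_shift T (proj ι (k + 1) x)).mapL (proj ι (k + 1))
  change HasSum _ (proj ι (k + 1) (shift T (proj ι (k + 1) x)))
  convert hs using 1
  funext i
  rw [proj_succ_rightCreation, hadj]
  exact congrArg (rightCreation i) (DFunLike.congr_fun hT.symm _)

/-- The restriction of `β` to the `β`-invariant algebra `𝔅`. -/
noncomputable def shiftB (ι : Type) : boundedSupport ι →ₗ[ℂ] boundedSupport ι where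
  toFun T := ⟨shift T, T.2.elim fun k hk => ⟨k + 1, shift_mem hk⟩⟩
  map_add' _ _ := Subtype.ext (shift_add _ _)
  map_smul' _ _ := Subtype.ext (shift_smul _ _)

theorem rankOne_mem {ι : Type} (μ ν : List ι) :
    InnerProductSpace.rankOne ℂ (basisVec μ : FockSpace ι) (basisVec ν) ∈ boundedSupport ι := by
  refine ⟨max μ.length ν.length, ?_⟩
  have hμ : proj ι (max μ.length ν.length) (basisVec μ) = basisVec μ :=
    Submodule.starProjection_eq_self_iff.2 (basisVec_mem_upTo (le_max_left _ _))
  have hν : proj ι (max μ.length ν.length) (basisVec ν) = basisVec ν :=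
    Submodule.starProjection_eq_self_iff.2 (basisVec_mem_upTo (le_max_right _ _))
  rw [mem_supportedUpTo]
  ext1 x
  have h : ⟪(basisVec ν : FockSpace ι), proj ι (max μ.length ν.length) x⟫_ℂ = ⟪basisVec ν, x⟫_ℂ := by
    conv_rhs => rw [← hν]
    exact (Submodule.inner_starProjection_left_eq_right _ _ _).symm
  simp [InnerProductSpace.rankOne_apply, h, hμ]

/-- The rank-one operator `|v_μ⟩⟨v_ν|`, as an element of `𝔅`. -/
noncomputable def rankOneB {ι : Type} (μ ν : List ι) : boundedSupport ι :=
  ⟨InnerProductSpace.rankOne ℂ (basisVec μ) (basisVec ν), rankOne_mem μ ν⟩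

end FockSpace

/-! ### Positive, decreasing and locally normal functionals -/

/-- A linear functional on a *-algebra is positive if it is nonnegative on all `a⋆ a`. -/
def IsPositiveFunctional {A : Type*} [NonUnitalSemiring A] [StarRing A] [Module ℂ A]
    (φ : A →ₗ[ℂ] ℂ) : Prop :=
  ∀ a : A, 0 ≤ φ (star a * a)

/-- The σ-weak (ultraweak) topology on the bounded operators of a Hilbert space: the coarsest
topology for which all functionals `T ↦ ∑ₘ ⟨T xₘ, yₘ⟩` with `∑ ‖xₘ‖² < ∞`, `∑ ‖yₘ‖² < ∞` are
continuous. -/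
@[reducible]
noncomputable def sigmaWeakTopology (H : Type*) [NormedAddCommGroup H] [InnerProductSpace ℂ H] :
    TopologicalSpace (H →L[ℂ] H) :=
  ⨅ p : {p : (ℕ → H) × (ℕ → H) //
      (Summable fun m => ‖p.1 m‖ ^ 2) ∧ Summable fun m => ‖p.2 m‖ ^ 2},
    TopologicalSpace.induced (fun T : H →L[ℂ] H => ∑' m, ⟪p.1.2 m, T (p.1.1 m)⟫_ℂ) inferInstance

namespace FockSpace

/-- `ω` is decreasing: `ω(B⋆B) - ω(β(B⋆B)) ≥ 0` for all `B ∈ 𝔅`. -/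
def IsDecreasing {ι : Type} (ω : boundedSupport ι →ₗ[ℂ] ℂ) : Prop :=
  ∀ B : boundedSupport ι, 0 ≤ ω (star B * B) - ω (shiftB ι (star B * B))

/-- The σ-weak topology on the von Neumann algebra `𝔅_k`, viewed as a subset of `𝔅`. -/
@[reducible]
noncomputable def levelTopology (ι : Type) (k : ℕ) :
    TopologicalSpace {B : boundedSupport ι // (B : FockSpace ι →L[ℂ] FockSpace ι) ∈
      supportedUpTo ι k} :=
  TopologicalSpace.induced (fun B => (B.1 : FockSpace ι →L[ℂ] FockSpace ι))
    (sigmaWeakTopology (FockSpace ι))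

/-- `ω` is locally normal: its restriction to each von Neumann algebra `𝔅_k` is normal, that is,
σ-weakly continuous. -/
def IsLocallyNormal {ι : Type} (ω : boundedSupport ι →ₗ[ℂ] ℂ) : Prop :=
  ∀ k : ℕ, @Continuous _ ℂ (levelTopology ι k) inferInstance fun B => ω B.1

/-- The cone `𝒫_β` of decreasing positive linear functionals on `𝔅`. It is partially ordered by
`ω₁ ≤ ω₂ ↔ ω₂ - ω₁ ∈ 𝒫_β`. -/
def decreasingCone (ι : Type) : PointedCone ℝ (boundedSupport ι →ₗ[ℂ] ℂ) where
  carrier := {ω | IsPositiveFunctional ω ∧ IsDecreasing ω}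
  add_mem' := by
    rintro ω₁ ω₂ ⟨h₁, d₁⟩ ⟨h₂, d₂⟩
    refine ⟨fun B => add_nonneg (h₁ B) (h₂ B), fun B => ?_⟩
    simp only [LinearMap.add_apply, add_sub_add_comm]
    exact add_nonneg (d₁ B) (d₂ B)
  zero_mem' := ⟨fun B => by simp, fun B => by simp⟩
  smul_mem' := by
    rintro ⟨c, hc⟩ ω ⟨h, d⟩
    refine ⟨fun B => smul_nonneg hc (h B), fun B => ?_⟩
    have := smul_nonneg hc (d B)
    rwa [smul_sub] at this

/-- The subcone `𝒲_β` of `𝒫_β` of the decreasing locally normal positive linear functionals. -/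
def locallyNormalCone (ι : Type) : PointedCone ℝ (boundedSupport ι →ₗ[ℂ] ℂ) where
  carrier := {ω | ω ∈ decreasingCone ι ∧ IsLocallyNormal ω}
  add_mem' := by
    rintro ω₁ ω₂ ⟨h₁, d₁⟩ ⟨h₂, d₂⟩
    refine ⟨add_mem h₁ h₂, fun k => ?_⟩
    let _ := levelTopology ι k
    exact (d₁ k).add (d₂ k)
  zero_mem' := ⟨zero_mem _, fun k => by let _ := levelTopology ι k; exact continuous_const⟩
  smul_mem' := by
    rintro c ω ⟨h, d⟩
    refine ⟨Submodule.smul_mem _ c h, fun k => ?_⟩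
    let _ := levelTopology ι k
    exact (d k).const_smul (c : ℝ)

end FockSpace

/-- The positive part of the dual of a C*-algebra. -/
def positiveDual (A : Type*) [CStarAlgebra A] : PointedCone ℝ (StrongDual ℂ A) where
  carrier := {ρ | IsPositiveFunctional (ρ : A →ₗ[ℂ] ℂ)}
  add_mem' h₁ h₂ a := add_nonneg (h₁ a) (h₂ a)
  zero_mem' _ := le_rfl
  smul_mem' c _ h a := smul_nonneg c.2 (h a)

/-- The index set `{i : i < n}` of the generators, for `n ∈ {1, 2, …, ∞}`. -/
abbrev GeneratorIndex (n : ℕ∞) : Type := {i : ℕ // (i : ℕ∞) < n}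

/-! ### The Fock representation -/

namespace FockSpace

variable {ι : Type}

-- Let λ be the representation of the Toeplitz-Cuntz algebra on Fock space by left multiplication.
-- Left and right multiplications commute, so β(λ(v_μ v_ν⋆)) = λ(v_μ) β(1) λ(v_ν)⋆; and 1 - β(1) is
-- the projection onto the vacuum. Hence λ(x) - β(λ(x)) = |v_μ⟩⟨v_ν| for x = v_μ v_ν⋆
-- (`fockRep_sub_shift`), and the required ρ is x ↦ ω(λ(x) - β(λ(x))) on the dense *-algebra spanned
-- by these x.
--
-- Positivity of ρ is the main point: λ(x) usually has unbounded support, so ω cannot be applied to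
-- λ(x) and β(λ(x)) separately. In `apply_sub_shift_nonneg` the operator T ≥ 0 is replaced by its
-- compressions P_k T P_k. Decrease of ω makes the numbers ω(P_k T P_k) grow by at most ω(T - β(T))
-- at each step; being nonnegative, they could not do so forever if ω(T - β(T)) were negative. A
-- functional positive in this sense is dominated by its value at 1, hence bounded, and extends by
-- continuity.
--
-- Conversely, a positive ρ gives the form (x, y) ↦ ρ(x y⋆) on words of length at most k. For each
-- length j, the v_μ v_μ⋆ with |μ| = j are orthogonal projections, so their values under ρ sum to at
-- most ρ(1), and the form has trace at most (k+1) ρ(1). Its square root is Hilbert-Schmidt and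
-- yields vectors u_κ with ω(T) = ∑ ⟨T u_κ, u_κ⟩ on 𝔅_k, which is normal (`exists_summable_family`).
-- That ω is positive and decreasing is checked on finite matrices, where it reduces to positivity
-- of ρ and ∑ v_i v_i⋆ ≤ 1, and passes to the limit by normality
-- (`IsLocallyNormal.mem_decreasingCone`).
--
-- Density of the words on one side and normality on the other make both correspondences determined
-- by the values on words, which gives bijectivity; the order statement is the same argument applied
-- to ω₂ - ω₁.

instance : Nontrivial (FockSpace ι) :=
  ⟨basisVec [], 0, (orthonormal_basisVec ι).ne_zero []⟩

theorem hasSum_basisVec (x : FockSpace ι) :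
    HasSum (fun μ => x μ • (basisVec μ : FockSpace ι)) x := by
  classical
  convert lp.hasSum_single (p := 2) (by norm_num) x using 2 with μ
  rw [basisVec, ← lp.single_smul, smul_eq_mul, mul_one]

theorem orthonormal_basisVec_cons (i : ι) :
    Orthonormal ℂ (fun μ : List ι => (basisVec (i :: μ) : FockSpace ι)) :=
  (orthonormal_basisVec ι).comp _ (List.cons_injective)

/-- Left multiplication by `v_i` on Fock space: the isometry `v_μ ↦ v_i v_μ`. -/
noncomputable def leftCreation (i : ι) : FockSpace ι →ₗᵢ[ℂ] FockSpace ι :=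
  (orthonormal_basisVec_cons i).orthogonalFamily.linearIsometry

theorem leftCreation_basisVec (i : ι) (μ : List ι) :
    leftCreation i (basisVec μ) = basisVec (i :: μ) := by
  classical
  have h := (orthonormal_basisVec_cons i).orthogonalFamily.linearIsometry_apply_single
    (i := μ) (1 : ℂ)
  rw [LinearIsometry.toSpanSingleton_apply, one_smul] at h
  rw [← h, basisVec]
  rfl

/-- Both Toeplitz-Cuntz relations are instances: c = 1 for equal indices and c = 0 for distinct
ones. -/
theorem star_mul_eq_of_basisVec {S T : FockSpace ι →L[ℂ] FockSpace ι} {c : ℂ}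
    (h : ∀ μ ν, ⟪S (basisVec μ), T (basisVec ν)⟫_ℂ = c * ⟪(basisVec μ : FockSpace ι), basisVec ν⟫_ℂ) :
    star S * T = c • 1 := by
  classical
  refine ext_basisVec fun ν => lp.ext (funext fun μ => ?_)
  rw [← inner_basisVec, ← inner_basisVec]
  change ⟪basisVec μ, ContinuousLinearMap.adjoint S (T (basisVec ν))⟫_ℂ = _
  rw [ContinuousLinearMap.adjoint_inner_right, h]
  simp

theorem isToeplitzCuntzFamily_leftCreation :
    IsToeplitzCuntzFamily fun i : ι => (leftCreation i).toContinuousLinearMap := by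
  classical
  refine ⟨fun i => ?_, fun i j hij => ?_⟩
  · rw [star_mul_eq_of_basisVec (c := 1), one_smul]
    intro μ ν
    simp
  · rw [star_mul_eq_of_basisVec (c := 0), zero_smul]
    intro μ ν
    simp only [LinearIsometry.coe_toContinuousLinearMap, leftCreation_basisVec, zero_mul]
    exact (orthonormal_basisVec ι).inner_eq_zero (by simp [Ne.symm hij])

theorem exists_fockRep (ι : Type) :
    ∃ φ : ToeplitzCuntz ι →⋆ₐ[ℂ] (FockSpace ι →L[ℂ] FockSpace ι),
      ∀ i, φ (ToeplitzCuntz.gen i) = (leftCreation i).toContinuousLinearMap :=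
  ToeplitzCuntz.exists_lift _ isToeplitzCuntzFamily_leftCreation

/-- The Fock representation of the Toeplitz-Cuntz algebra, by left multiplication. -/
noncomputable def fockRep (ι : Type) :
    ToeplitzCuntz ι →⋆ₐ[ℂ] (FockSpace ι →L[ℂ] FockSpace ι) := (exists_fockRep ι).choose

theorem fockRep_gen (i : ι) :
    fockRep ι (ToeplitzCuntz.gen i) = (leftCreation i).toContinuousLinearMap :=
  (exists_fockRep ι).choose_spec i

theorem fockRep_word_basisVec (μ κ : List ι) :
    fockRep ι (ToeplitzCuntz.word μ) (basisVec κ) = basisVec (μ ++ κ) := by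
  induction μ with
  | nil => simp [ToeplitzCuntz.word]
  | cons i μ ih =>
    have : ToeplitzCuntz.word (i :: μ) = ToeplitzCuntz.gen i * ToeplitzCuntz.word μ := by
      simp [ToeplitzCuntz.word]
    rw [this, map_mul, mul_apply_eq_comp, ih, fockRep_gen,
      LinearIsometry.coe_toContinuousLinearMap, leftCreation_basisVec, List.cons_append]

/-- Left multiplications commute with right multiplications. -/
theorem fockRep_word_rightCreation (μ : List ι) (i : ι) (x : FockSpace ι) :
    fockRep ι (ToeplitzCuntz.word μ) (rightCreation i x) =
      rightCreation i (fockRep ι (ToeplitzCuntz.word μ) x) := by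
  have h : fockRep ι (ToeplitzCuntz.word μ) * (rightCreation i).toContinuousLinearMap =
      (rightCreation i).toContinuousLinearMap * fockRep ι (ToeplitzCuntz.word μ) := by
    refine ext_basisVec fun κ => ?_
    change fockRep ι (ToeplitzCuntz.word μ) (rightCreation i (basisVec κ)) =
      rightCreation i (fockRep ι (ToeplitzCuntz.word μ) (basisVec κ))
    rw [fockRep_word_basisVec, rightCreation_basisVec, rightCreation_basisVec,
      fockRep_word_basisVec, List.append_assoc]
  exact DFunLike.congr_fun h x

open ContinuousLinearMap in
/-- If `S` and `M` intertwine the right creation operators with `S'` and `M'`, then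
`S β(A) M⋆ = β(S' A M'⋆)`. -/
theorem mul_shift_mul_star {S S' M M' : FockSpace ι →L[ℂ] FockSpace ι}
    (hS : ∀ i x, S (rightCreation i x) = rightCreation i (S' x))
    (hM : ∀ i x, M (rightCreation i x) = rightCreation i (M' x))
    (A : FockSpace ι →L[ℂ] FockSpace ι) :
    S * shift A * star M = shift (S' * A * star M') := by
  have hadj : ∀ (i : ι) (x : FockSpace ι),
      adjoint (rightCreation i).toContinuousLinearMap (star M x) =
        star M' (adjoint (rightCreation i).toContinuousLinearMap x) := by
    intro i x
    have h : M * (rightCreation i).toContinuousLinearMap =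
        (rightCreation i).toContinuousLinearMap * M' := by
      ext1 y; exact hM i y
    have h' := congrArg star h
    rw [star_mul, star_mul] at h'
    exact DFunLike.congr_fun h' x
  ext1 x
  refine HasSum.unique ?_ (hasSum_shift _ x)
  have hs := (hasSum_shift A (star M x)).mapL S
  change HasSum _ (S (shift A (star M x)))
  convert hs using 1
  funext i
  rw [hS, hadj]
  rfl

/-- Right multiplication by a letter raises length by one, so P_{k+1} r(v_i) = r(v_i) P_k. This
shift of the index is what makes the compressions telescope in `apply_sub_shift_nonneg`. -/
theorem shift_conj_proj (k : ℕ) (A : FockSpace ι →L[ℂ] FockSpace ι) :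
    shift (proj ι k * A * proj ι k) = proj ι (k + 1) * shift A * proj ι (k + 1) := by
  have := mul_shift_mul_star (proj_succ_rightCreation k) (proj_succ_rightCreation k) A
  rw [star_proj, star_proj] at this
  exact this.symm

open ContinuousLinearMap in
theorem adjoint_rightCreation_basisVec_nil (i : ι) :
    adjoint (rightCreation i).toContinuousLinearMap (basisVec []) = 0 := by
  refine lp.ext (funext fun μ => ?_)
  rw [← inner_basisVec, adjoint_inner_right, LinearIsometry.coe_toContinuousLinearMap,
    rightCreation_basisVec]
  exact (orthonormal_basisVec ι).inner_eq_zero (by simp)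

open ContinuousLinearMap in
theorem adjoint_rightCreation_apply (i : ι) (x : FockSpace ι) (μ : List ι) :
    adjoint (rightCreation i).toContinuousLinearMap x μ = x (μ ++ [i]) := by
  rw [← inner_basisVec, adjoint_inner_right, LinearIsometry.coe_toContinuousLinearMap,
    rightCreation_basisVec, inner_basisVec]

open ContinuousLinearMap in
theorem adjoint_rightCreation_basisVec_append [DecidableEq ι] (i j : ι) (κ : List ι) :
    adjoint (rightCreation i).toContinuousLinearMap (basisVec (κ ++ [j])) =
      if i = j then basisVec κ else 0 := by
  classical
  refine lp.ext (funext fun μ => ?_)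
  rw [adjoint_rightCreation_apply, basisVec_apply]
  by_cases h : i = j <;> simp [h, basisVec_apply]

/-- A nonempty word has exactly one last letter, so exactly one r(v_i) r(v_i)⋆ fixes it and the
others kill it; the empty word is killed by all. -/
theorem one_sub_shift_one :
    1 - shift (1 : FockSpace ι →L[ℂ] FockSpace ι) =
      InnerProductSpace.rankOne ℂ (basisVec []) (basisVec []) := by
  classical
  refine ext_basisVec fun κ => ?_
  have h := hasSum_shift (1 : FockSpace ι →L[ℂ] FockSpace ι) (basisVec κ)
  simp only [one_apply_eq_self, sub_apply,
    InnerProductSpace.rankOne_apply] at h ⊢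
  rcases List.eq_nil_or_concat' κ with rfl | ⟨κ, j, rfl⟩
  · have h0 : shift (1 : FockSpace ι →L[ℂ] FockSpace ι) (basisVec []) = 0 := by
      refine h.unique ?_
      simp only [adjoint_rightCreation_basisVec_nil, map_zero]
      exact hasSum_zero
    rw [h0, sub_zero, inner_self_eq_norm_sq_to_K, (orthonormal_basisVec ι).1]
    simp
  · have h0 : shift (1 : FockSpace ι →L[ℂ] FockSpace ι) (basisVec (κ ++ [j])) =
        basisVec (κ ++ [j]) := by
      refine h.unique ?_
      convert hasSum_ite_eq j (basisVec (κ ++ [j]) : FockSpace ι) using 2 with i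
      rw [adjoint_rightCreation_basisVec_append]
      split_ifs with hi
      · subst hi; rw [rightCreation_basisVec]
      · rw [map_zero]
    rw [h0, sub_self, (orthonormal_basisVec ι).inner_eq_zero (by simp), zero_smul]

/-- In the Fock representation, `v_μ v_ν⋆ - β(v_μ v_ν⋆) = |v_μ⟩⟨v_ν|`. -/
theorem fockRep_sub_shift (μ ν : List ι) :
    fockRep ι (ToeplitzCuntz.word μ * star (ToeplitzCuntz.word ν)) -
      shift (fockRep ι (ToeplitzCuntz.word μ * star (ToeplitzCuntz.word ν))) =
      InnerProductSpace.rankOne ℂ (basisVec μ) (basisVec ν) := by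
  -- Commutation lets λ(v_μ) and λ(v_ν)⋆ be pulled out of β, leaving the vacuum projection 1 - β(1)
  -- between them.
  have h := mul_shift_mul_star (fockRep_word_rightCreation μ) (fockRep_word_rightCreation ν) 1
  rw [mul_one] at h
  rw [map_mul, map_star, ← h]
  calc _ = fockRep ι (ToeplitzCuntz.word μ) * (1 - shift 1) *
        star (fockRep ι (ToeplitzCuntz.word ν)) := by noncomm_ring
    _ = _ := by
      rw [one_sub_shift_one]
      ext1 x
      have e := ContinuousLinearMap.adjoint_inner_right (fockRep ι (ToeplitzCuntz.word ν))
        (basisVec []) x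
      simp only [fockRep_word_basisVec, List.append_nil] at e
      simp only [mul_apply_eq_comp, InnerProductSpace.rankOne_apply, map_smul,
        fockRep_word_basisVec, List.append_nil, ← e]
      rfl

end FockSpace

-- Density of the span of the elements v_μ v_ν⋆

namespace ToeplitzCuntz

variable {ι : Type}

theorem word_cons (i : ι) (μ : List ι) : word (i :: μ) = gen i * word μ := by
  simp [word]

theorem word_append (μ ν : List ι) : word (μ ++ ν) = word μ * word ν := by
  simp [word]

/-- The linear span of the elements `v_μ v_ν⋆`. -/
noncomputable def wordSpan (ι : Type) : Submodule ℂ (ToeplitzCuntz ι) :=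
  Submodule.span ℂ (Set.range fun p : List ι × List ι => word p.1 * star (word p.2))

theorem word_mul_star_word_mem (μ ν : List ι) : word μ * star (word ν) ∈ wordSpan ι :=
  Submodule.subset_span ⟨(μ, ν), rfl⟩

/-- The span contains 1 and is stable under left multiplication by v_i and v_i⋆: the factor v_i⋆
cancels or annihilates the first letter of v_μ, and when μ is empty it is absorbed by v_i⋆ v_ν⋆ =
(v_ν v_i)⋆. -/
theorem adjoin_gen_le_wordSpan :
    Subalgebra.toSubmodule (StarAlgebra.adjoin ℂ (Set.range (gen (ι := ι)))).toSubalgebra ≤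
      wordSpan ι := by
  classical
  rw [StarAlgebra.adjoin_toSubalgebra, Algebra.adjoin_eq_span, Submodule.span_le]
  have hmul : ∀ a ∈ Set.range (gen (ι := ι)) ∪ star (Set.range gen), ∀ y ∈ wordSpan ι,
      a * y ∈ wordSpan ι := by
    intro a ha y hy
    induction hy using Submodule.span_induction with
    | mem y hy =>
      obtain ⟨⟨μ, ν⟩, rfl⟩ := hy
      rcases ha with ⟨i, rfl⟩ | ⟨i, hi⟩
      · change gen i * (word μ * star (word ν)) ∈ _
        rw [← mul_assoc, ← word_cons]
        exact word_mul_star_word_mem _ _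
      · obtain rfl : a = star (gen i) := by rw [hi, star_star]
        change star (gen i) * (word μ * star (word ν)) ∈ _
        rcases μ with _ | ⟨j, μ⟩
        · have : star (gen i) * (word [] * star (word ν)) =
              word [] * star (word (ν ++ [i])) := by
            rw [word_append, star_mul]; simp [word]
          rw [this]
          exact word_mul_star_word_mem _ _
        · rw [word_cons, ← mul_assoc, ← mul_assoc]
          by_cases h : j = i
          · subst h
            rw [(isToeplitzCuntzFamily_gen ι).1, one_mul]
            exact word_mul_star_word_mem _ _
          · rw [(isToeplitzCuntzFamily_gen ι).2 j i h, zero_mul, zero_mul]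
            exact zero_mem _
    | zero => rw [mul_zero]; exact zero_mem _
    | add x y _ _ hx hy => rw [mul_add]; exact add_mem hx hy
    | smul c x _ hx => rw [mul_smul_comm]; exact Submodule.smul_mem _ _ hx
  intro x hx
  induction hx using Submonoid.closure_induction_left with
  | one =>
    have : (1 : ToeplitzCuntz ι) = word [] * star (word []) := by simp [word]
    rw [this]
    exact word_mul_star_word_mem _ _
  | mul_left a ha y _ hy => exact hmul a ha y hy

theorem dense_coe_adjoin_gen (ι : Type) :
    Dense (StarAlgebra.adjoin ℂ (Set.range (gen (ι := ι))) : Set (ToeplitzCuntz ι)) := by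
  rw [dense_iff_closure_eq, ← StarSubalgebra.topologicalClosure_coe, dense_adjoin_gen]
  rfl

/-- Continuous linear functionals which agree on all `v_μ v_ν⋆` are equal. -/
theorem ext_word {ρ₁ ρ₂ : StrongDual ℂ (ToeplitzCuntz ι)}
    (h : ∀ μ ν : List ι, ρ₁ (word μ * star (word ν)) = ρ₂ (word μ * star (word ν))) :
    ρ₁ = ρ₂ := by
  have hspan : ∀ x ∈ wordSpan ι, ρ₁ x = ρ₂ x := by
    intro x hx
    induction hx using Submodule.span_induction with
    | mem y hy => obtain ⟨⟨μ, ν⟩, rfl⟩ := hy; exact h μ ν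
    | zero => simp
    | add x y _ _ hx hy => simp [hx, hy]
    | smul c x _ hx => simp [hx]
  refine DFunLike.coe_injective (Continuous.ext_on (dense_coe_adjoin_gen ι) ρ₁.continuous ρ₂.continuous ?_)
  exact fun x hx => hspan x (adjoin_gen_le_wordSpan hx)

end ToeplitzCuntz

/-! ### From decreasing functionals to functionals on the Toeplitz-Cuntz algebra -/

theorem CStarAlgebra.exists_nonneg_mul_self {A : Type*} [CStarAlgebra A] [PartialOrder A]
    [StarOrderedRing A] {a : A} (ha : 0 ≤ a) : ∃ s : A, 0 ≤ s ∧ s * s = a :=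
  ⟨CFC.sqrt a, CFC.sqrt_nonneg a, CFC.sqrt_mul_sqrt_self a⟩

namespace FockSpace

variable {ι : Type}

/-- The positive square root S stays in 𝔅_k, since (S(1 - P_k))⋆ S(1 - P_k) = (1 - P_k) T (1 - P_k)
= 0. Conditions on elements B⋆B thus become conditions on all positive operators in 𝔅. -/
theorem exists_star_mul_self_eq {k : ℕ} {T : FockSpace ι →L[ℂ] FockSpace ι} (h0 : 0 ≤ T)
    (hT : T ∈ supportedUpTo ι k) : ∃ C ∈ supportedUpTo ι k, star C * C = T := by
  obtain ⟨S, hS0, hSS⟩ := CStarAlgebra.exists_nonneg_mul_self h0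
  have hS : star S = S := (IsSelfAdjoint.of_nonneg hS0).star_eq
  have h1 : T * (1 - proj ι k) = 0 := by
    rw [mem_supportedUpTo] at hT
    rw [← hT, mul_assoc, mul_sub, mul_one, proj_idem, sub_self, mul_zero]
  have h2 : S * (1 - proj ι k) = 0 := by
    rw [← CStarRing.star_mul_self_eq_zero_iff, star_mul, hS, mul_assoc, ← mul_assoc S S, hSS, h1,
      mul_zero]
  have h3 : S * proj ι k = S := by
    rw [mul_sub, mul_one, sub_eq_zero] at h2
    exact h2.symm
  refine ⟨S, ?_, by rw [hS, hSS]⟩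
  have h4 := congrArg star h3
  rw [star_mul, star_proj, hS] at h4
  rw [mem_supportedUpTo, h4, h3]

theorem nonneg_apply_of_mem_decreasingCone {ω : boundedSupport ι →ₗ[ℂ] ℂ}
    (hω : ω ∈ decreasingCone ι) {B : boundedSupport ι}
    (hB : 0 ≤ (B : FockSpace ι →L[ℂ] FockSpace ι)) : 0 ≤ ω B ∧ 0 ≤ ω B - ω (shiftB ι B) := by
  obtain ⟨k, hk⟩ := B.2
  obtain ⟨C, hC, h⟩ := exists_star_mul_self_eq hB hk
  obtain rfl : star (⟨C, k, hC⟩ : boundedSupport ι) * ⟨C, k, hC⟩ = B := Subtype.ext h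
  exact ⟨hω.1 _, hω.2 _⟩

theorem conj_proj_mem (k : ℕ) (T : FockSpace ι →L[ℂ] FockSpace ι) :
    proj ι k * T * proj ι k ∈ supportedUpTo ι k := by
  rw [mem_supportedUpTo]
  have := proj_idem ι k
  calc _ = (proj ι k * proj ι k) * T * (proj ι k * proj ι k) := by simp only [mul_assoc]
    _ = _ := by rw [this]

/-- A decreasing positive functional is nonnegative on `T - β(T)` if `T ≥ 0`, for any bounded
operator `T`, whether it has bounded support or not. -/
theorem apply_sub_shift_nonneg {ω : boundedSupport ι →ₗ[ℂ] ℂ} (hω : ω ∈ decreasingCone ι)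
    {T : FockSpace ι →L[ℂ] FockSpace ι} (hT : 0 ≤ T) {D : boundedSupport ι}
    (hD : (D : FockSpace ι →L[ℂ] FockSpace ι) = T - shift T) : 0 ≤ ω D := by
  let B : ℕ → boundedSupport ι := fun k => ⟨proj ι k * T * proj ι k, k, conj_proj_mem k T⟩
  have hB : ∀ k, 0 ≤ (B k : FockSpace ι →L[ℂ] FockSpace ι) := fun k => by
    have := star_left_conjugate_nonneg hT (proj ι k)
    rwa [star_proj] at this
  obtain ⟨k₀, hk₀⟩ := D.2
  -- With B_k = P_k T P_k, β(B_k) is the compression of β(T) = T - D by P_{k+1}, and D is unchanged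
  -- by that compression once k ≥ k₀.
  have key : ∀ k, k₀ ≤ k → B k - shiftB ι (B k) = D - (B (k + 1) - B k) := by
    intro k hk
    have h1 := supportedUpTo_mono ι (hk.trans k.le_succ) hk₀
    rw [mem_supportedUpTo] at h1
    refine Subtype.ext ?_
    change proj ι k * T * proj ι k - shift (proj ι k * T * proj ι k) = D.1 -
      (proj ι (k + 1) * T * proj ι (k + 1) - proj ι k * T * proj ι k)
    rw [shift_conj_proj, ← h1, hD]
    noncomm_ring
  have hstep : ∀ k, k₀ ≤ k → 0 ≤ ω D - (ω (B (k + 1)) - ω (B k)) := by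
    intro k hk
    have := (nonneg_apply_of_mem_decreasingCone hω (hB k)).2
    rwa [← map_sub, key k hk, map_sub, map_sub] at this
  have hf : ∀ k, 0 ≤ ω (B k) := fun k => (nonneg_apply_of_mem_decreasingCone hω (hB k)).1
  have him : (ω D).im = 0 := by
    have h := (Complex.nonneg_iff.1 (hstep k₀ le_rfl)).2
    have h1 := (Complex.nonneg_iff.1 (hf k₀)).2
    have h2 := (Complex.nonneg_iff.1 (hf (k₀ + 1))).2
    simp only [Complex.sub_im] at h
    linarith
  refine Complex.nonneg_iff.2 ⟨?_, him.symm⟩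
  -- If Re ω(D) were negative, this linear bound would eventually contradict ω(B_k) ≥ 0.
  have hlin : ∀ n : ℕ, (ω (B (k₀ + n))).re ≤ (ω (B k₀)).re + n * (ω D).re := by
    intro n
    induction n with
    | zero => simp
    | succ n ih =>
      have h := (Complex.nonneg_iff.1 (hstep (k₀ + n) (by omega))).1
      simp only [Complex.sub_re] at h
      push_cast
      rw [← add_assoc]
      linarith
  by_contra! hneg
  obtain ⟨n, hn⟩ := exists_nat_gt ((ω (B k₀)).re / -(ω D).re)
  rw [div_lt_iff₀ (by linarith)] at hn
  have := (Complex.nonneg_iff.1 (hf (k₀ + n))).1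
  have := hlin n
  linarith

theorem fockRep_sub_shift_mem {x : ToeplitzCuntz ι} (hx : x ∈ ToeplitzCuntz.wordSpan ι) :
    fockRep ι x - shift (fockRep ι x) ∈ boundedSupport ι := by
  induction hx using Submodule.span_induction with
  | mem x hx =>
    obtain ⟨⟨μ, ν⟩, rfl⟩ := hx
    rw [fockRep_sub_shift]
    exact rankOne_mem μ ν
  | zero =>
    rw [map_zero, show shift (0 : FockSpace ι →L[ℂ] FockSpace ι) = 0 by
      simpa using shift_smul 0 (0 : FockSpace ι →L[ℂ] FockSpace ι), sub_zero]
    exact zero_mem _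
  | add x y _ _ hx hy =>
    rw [map_add, shift_add, add_sub_add_comm]
    exact add_mem hx hy
  | smul c x _ hx =>
    rw [map_smul, shift_smul, ← smul_sub]
    exact SMulMemClass.smul_mem c hx

/-- The linear map `v_μ v_ν⋆ ↦ |v_μ⟩⟨v_ν|`. -/
noncomputable def wordDefect (ι : Type) : ToeplitzCuntz.wordSpan ι →ₗ[ℂ] boundedSupport ι where
  toFun x := ⟨fockRep ι x - shift (fockRep ι x), fockRep_sub_shift_mem x.2⟩
  map_add' x y := Subtype.ext <| by
    change fockRep ι (x.1 + y.1) - shift (fockRep ι (x.1 + y.1)) =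
      (fockRep ι x - shift (fockRep ι x)) + (fockRep ι y - shift (fockRep ι y))
    rw [map_add, shift_add, add_sub_add_comm]
  map_smul' c x := Subtype.ext <| by
    change fockRep ι (c • x.1) - shift (fockRep ι (c • x.1)) =
      c • (fockRep ι x - shift (fockRep ι x))
    rw [map_smul, shift_smul, ← smul_sub]

theorem apply_wordDefect_nonneg {ω : boundedSupport ι →ₗ[ℂ] ℂ} (hω : ω ∈ decreasingCone ι)
    {x : ToeplitzCuntz.wordSpan ι} (hx : 0 ≤ fockRep ι x) : 0 ≤ ω (wordDefect ι x) :=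
  apply_sub_shift_nonneg hω hx rfl

end FockSpace

/-- A linear functional on a *-subalgebra of a C*-algebra which is positive with respect to the
order of some representation is bounded. -/
theorem StarSubalgebra.exists_norm_apply_le_of_nonneg {A B : Type*} [CStarAlgebra A]
    [CStarAlgebra B] [PartialOrder B] [StarOrderedRing B] (φ : A →⋆ₐ[ℂ] B)
    (S : StarSubalgebra ℂ A) (f : S →ₗ[ℂ] ℂ) (hf : ∀ x : S, 0 ≤ φ x → 0 ≤ f x) :
    ∃ C : ℝ, ∀ x : S, ‖f x‖ ≤ C * ‖(x : A)‖ := by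
  have hsa : ∀ x : S, IsSelfAdjoint x → ‖f x‖ ≤ (f 1).re * ‖(x : A)‖ := by
    intro x hx
    -- The unit is an order unit: ‖y‖·1 - y has positive image under φ. Taking y = x and y = -x
    -- bounds f(x) on both sides.
    have hle : ∀ y : S, IsSelfAdjoint y → 0 ≤ (((‖(y : A)‖ : ℝ) : ℂ) • f 1 - f y) := by
      intro y hy
      rw [← map_smul, ← map_sub]
      refine hf _ ?_
      have hy' : IsSelfAdjoint (φ (y : A)) := by
        have : IsSelfAdjoint (y : A) := congrArg Subtype.val hy
        exact this.map φ
      have h1 := hy'.le_algebraMap_norm_self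
      have h2 : algebraMap ℝ B ‖φ (y : A)‖ ≤ algebraMap ℝ B ‖(y : A)‖ :=
        algebraMap_mono B (NonUnitalStarAlgHom.norm_apply_le φ (y : A))
      have h3 := sub_nonneg.2 (h1.trans h2)
      have h4 : φ ((((‖(y : A)‖ : ℝ) : ℂ) • (1 : S) - y : S) : A) =
          algebraMap ℝ B ‖(y : A)‖ - φ (y : A) := by
        change φ (((‖(y : A)‖ : ℝ) : ℂ) • (1 : A) - (y : A)) = _
        rw [map_sub, map_smul, map_one, Complex.coe_smul, Algebra.algebraMap_eq_smul_one]
      rwa [h4]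
    have h1 := Complex.nonneg_iff.1 (hle x hx)
    have h2 := Complex.nonneg_iff.1 (hle (-x) hx.neg)
    have h3 := Complex.nonneg_iff.1 (hf 1 (by simp))
    simp only [smul_eq_mul, Complex.sub_re, Complex.sub_im, Complex.re_ofReal_mul,
      Complex.im_ofReal_mul, map_neg, Complex.neg_re, Complex.neg_im, NegMemClass.coe_neg,
      norm_neg] at h1 h2
    have him : (f x).im = 0 := by
      have := h1.2
      rw [← h3.2, mul_zero] at this
      linarith
    have hre : f x = ((f x).re : ℂ) := Complex.ext rfl (by simpa using him)
    rw [hre, Complex.norm_real, Real.norm_eq_abs, abs_le]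
    constructor <;> linarith [h1.1, h2.1]
  have h1re : 0 ≤ (f 1).re := (Complex.nonneg_iff.1 (hf 1 (by simp))).1
  -- The factor 2 counts the real and imaginary parts of x, each of norm at most ‖x‖.
  refine ⟨2 * (f 1).re, fun x => ?_⟩
  let a : S := (1 / 2 : ℂ) • (x + star x)
  let b : S := (1 / 2 : ℂ) • (Complex.I • (star x - x))
  have ha : IsSelfAdjoint a := by
    simp [a, isSelfAdjoint_iff, add_comm]
  have hb : IsSelfAdjoint b := by
    simp only [b, isSelfAdjoint_iff, star_smul, star_sub, star_star]
    simp [← smul_neg]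
  have hx : x = a + Complex.I • b := by
    simp only [a, b, smul_smul, smul_add, smul_sub]
    have : Complex.I * (1 / 2 * Complex.I) = -(1 / 2) := by
      linear_combination (1 / 2 : ℂ) * Complex.I_mul_I
    rw [this]
    module
  have hna : ‖(a : A)‖ ≤ ‖(x : A)‖ := by
    have : (a : A) = (1 / 2 : ℂ) • ((x : A) + star (x : A)) := rfl
    rw [this, norm_smul]
    have := norm_add_le (x : A) (star (x : A))
    rw [norm_star] at this
    norm_num
    linarith
  have hnb : ‖(b : A)‖ ≤ ‖(x : A)‖ := by
    have : (b : A) = (1 / 2 : ℂ) • (Complex.I • (star (x : A) - (x : A))) := rfl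
    rw [this, norm_smul, norm_smul]
    have := norm_sub_le (star (x : A)) (x : A)
    rw [norm_star] at this
    norm_num
    linarith
  calc ‖f x‖ = ‖f a + Complex.I • f b‖ := by rw [← map_smul, ← map_add, ← hx]
    _ ≤ ‖f a‖ + ‖f b‖ := by
      refine (norm_add_le _ _).trans ?_
      rw [norm_smul, Complex.norm_I, one_mul]
    _ ≤ (f 1).re * ‖(a : A)‖ + (f 1).re * ‖(b : A)‖ := add_le_add (hsa a ha) (hsa b hb)
    _ ≤ (f 1).re * ‖(x : A)‖ + (f 1).re * ‖(x : A)‖ := by gcongr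
    _ = _ := by ring

namespace ToeplitzCuntz

variable {ι : Type}

theorem word_mem_adjoin (μ : List ι) :
    word μ ∈ StarAlgebra.adjoin ℂ (Set.range (gen (ι := ι))) := by
  refine list_prod_mem fun x hx => ?_
  obtain ⟨i, _, rfl⟩ := List.mem_map.1 hx
  exact StarAlgebra.subset_adjoin ℂ _ ⟨i, rfl⟩

/-- A decreasing positive functional `ω` on `𝔅` gives rise to a positive functional `ρ` on the
Toeplitz-Cuntz algebra with `ρ(v_μ v_ν⋆) = ω(|v_μ⟩⟨v_ν|)`. -/
theorem exists_positiveDual_of_mem_decreasingCone {ω : FockSpace.boundedSupport ι →ₗ[ℂ] ℂ}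
    (hω : ω ∈ FockSpace.decreasingCone ι) :
    ∃ ρ ∈ positiveDual (ToeplitzCuntz ι),
      ∀ μ ν : List ι, ρ (word μ * star (word ν)) = ω (FockSpace.rankOneB μ ν) := by
  let S := StarAlgebra.adjoin ℂ (Set.range (gen (ι := ι)))
  have hS : ∀ x ∈ S, x ∈ wordSpan ι := fun x hx => adjoin_gen_le_wordSpan hx
  let e : S →ₗ[ℂ] ToeplitzCuntz ι := S.subtype.toAlgHom.toLinearMap
  let j : S →ₗ[ℂ] wordSpan ι := e.codRestrict (wordSpan ι) fun x => hS x x.2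
  -- Since the formula ω(λ(x) - β(λ(x))) depends on x alone, linear independence of the v_μ v_ν⋆ is
  -- not needed.
  let f : S →ₗ[ℂ] ℂ := ω ∘ₗ FockSpace.wordDefect ι ∘ₗ j
  have hf : ∀ x : S, 0 ≤ FockSpace.fockRep ι x → 0 ≤ f x := fun x hx =>
    FockSpace.apply_wordDefect_nonneg hω (x := j x) hx
  have hbound := S.exists_norm_apply_le_of_nonneg (FockSpace.fockRep ι) f hf
  have hdense : DenseRange e := by
    have : Set.range e = S := Subtype.range_coe
    rw [DenseRange, this]
    exact dense_coe_adjoin_gen ι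
  let ρ : StrongDual ℂ (ToeplitzCuntz ι) := f.extendOfNorm e
  have hρ : ∀ x : S, ρ x = f x := LinearMap.extendOfNorm_eq hdense hbound
  refine ⟨ρ, fun a => ?_, fun μ ν => ?_⟩
  · have hcl : IsClosed {a : ToeplitzCuntz ι | 0 ≤ ρ (star a * a)} :=
      isClosed_le continuous_const (by fun_prop)
    refine hcl.closure_subset_iff.2 (fun b hb => ?_) (dense_coe_adjoin_gen ι a)
    have hb' : b ∈ S := hb
    have hnn : 0 ≤ f (star ⟨b, hb'⟩ * ⟨b, hb'⟩) := hf _ <| by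
      change 0 ≤ FockSpace.fockRep ι (star b * b)
      rw [map_mul, map_star]
      exact star_mul_self_nonneg _
    rwa [← hρ] at hnn
  · have hm : word μ * star (word ν) ∈ S := mul_mem (word_mem_adjoin μ) (star_mem (word_mem_adjoin ν))
    rw [hρ ⟨_, hm⟩]
    exact congrArg ω (Subtype.ext (FockSpace.fockRep_sub_shift μ ν))

/-- Uniqueness is claimed among all positive linear functionals, so continuity must be derived
before density of the words can be used. -/
theorem continuous_of_isPositiveFunctional {A : Type*} [CStarAlgebra A] {ρ : A →ₗ[ℂ] ℂ}
    (hρ : IsPositiveFunctional ρ) : Continuous ρ := by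
  let _ := CStarAlgebra.spectralOrder A
  have _ := CStarAlgebra.spectralOrderedRing A
  let f : A →ₚ[ℂ] ℂ := PositiveLinearMap.mk₀ ρ fun a ha => by
    obtain ⟨b, rfl⟩ := CStarAlgebra.nonneg_iff_eq_star_mul_self.1 ha
    exact hρ b
  exact map_continuous f

end ToeplitzCuntz

/-! ### Locally normal functionals -/

section

open Filter Topology

section SigmaWeak

variable {H : Type*} [NormedAddCommGroup H] [InnerProductSpace ℂ H]

theorem norm_inner_apply_le_sq_add_sq {T : H →L[ℂ] H} {C : ℝ} (hT : ‖T‖ ≤ C) (x y : H) :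
    ‖⟪y, T x⟫_ℂ‖ ≤ C * (‖x‖ ^ 2 + ‖y‖ ^ 2) := by
  have hC : 0 ≤ C := (norm_nonneg T).trans hT
  have h1 : ‖y‖ * ‖x‖ ≤ ‖x‖ ^ 2 + ‖y‖ ^ 2 := by
    nlinarith [sq_nonneg (‖x‖ - ‖y‖), sq_nonneg ‖x‖, sq_nonneg ‖y‖]
  calc ‖⟪y, T x⟫_ℂ‖ ≤ ‖y‖ * ‖T x‖ := norm_inner_le_norm _ _
    _ ≤ ‖y‖ * (C * ‖x‖) := by gcongr; exact T.le_of_opNorm_le hT x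
    _ = C * (‖y‖ * ‖x‖) := by ring
    _ ≤ _ := by gcongr

theorem summable_inner_apply {κ : Type*} {x y : κ → H} (hx : Summable fun m => ‖x m‖ ^ 2)
    (hy : Summable fun m => ‖y m‖ ^ 2) (T : H →L[ℂ] H) : Summable fun m => ⟪y m, T (x m)⟫_ℂ :=
  ((hx.add hy).mul_left ‖T‖).of_norm_bounded fun m =>
    norm_inner_apply_le_sq_add_sq le_rfl (x m) (y m)

/-- The functionals `T ↦ ∑ₘ ⟨T xₘ, yₘ⟩` are continuous along bounded nets which converge in the weak
operator topology. -/
theorem tendsto_tsum_inner_apply {κ α : Type*} {l : Filter α} {x y : κ → H}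
    (hx : Summable fun m => ‖x m‖ ^ 2) (hy : Summable fun m => ‖y m‖ ^ 2)
    {T : α → H →L[ℂ] H} {T₀ : H →L[ℂ] H} {C : ℝ} (hC : ∀ a, ‖T a‖ ≤ C)
    (hT : ∀ x y : H, Tendsto (fun a => ⟪y, T a x⟫_ℂ) l (𝓝 ⟪y, T₀ x⟫_ℂ)) :
    Tendsto (fun a => ∑' m, ⟪y m, T a (x m)⟫_ℂ) l (𝓝 (∑' m, ⟪y m, T₀ (x m)⟫_ℂ)) :=
  tendsto_tsum_of_dominated_convergence ((hx.add hy).mul_left C) (fun m => hT (x m) (y m))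
    (Eventually.of_forall fun a m => norm_inner_apply_le_sq_add_sq (hC a) (x m) (y m))

/-- The topology is defined by sequences, whereas the vectors that arise later are indexed by words;
extension by zero along an injection into ℕ bridges the two. -/
theorem continuous_sigmaWeakTopology {κ : Type*} [Countable κ] {x y : κ → H}
    (hx : Summable fun m => ‖x m‖ ^ 2) (hy : Summable fun m => ‖y m‖ ^ 2) :
    @Continuous _ _ (sigmaWeakTopology H) inferInstance
      fun T : H →L[ℂ] H => ∑' m, ⟪y m, T (x m)⟫_ℂ := by
  obtain ⟨e, he⟩ := exists_injective_nat κ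
  have hsq : ∀ z : κ → H, (fun m => ‖Function.extend e z 0 m‖ ^ 2) =
      Function.extend e (fun m => ‖z m‖ ^ 2) 0 := by
    intro z
    funext m
    by_cases hm : ∃ c, e c = m
    · obtain ⟨c, rfl⟩ := hm
      rw [he.extend_apply, he.extend_apply]
    · rw [Function.extend_apply' _ _ _ hm, Function.extend_apply' _ _ _ hm]
      simp
  let p : {p : (ℕ → H) × (ℕ → H) //
      (Summable fun m => ‖p.1 m‖ ^ 2) ∧ Summable fun m => ‖p.2 m‖ ^ 2} :=
    ⟨(Function.extend e x 0, Function.extend e y 0), by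
      simp only [hsq]
      exact ⟨(summable_extend_zero he).2 hx, (summable_extend_zero he).2 hy⟩⟩
  have hp : (fun T : H →L[ℂ] H => ∑' m, ⟪y m, T (x m)⟫_ℂ) =
      fun T : H →L[ℂ] H => ∑' m, ⟪p.1.2 m, T (p.1.1 m)⟫_ℂ := by
    funext T
    rw [← tsum_extend_zero he]
    congr 1
    funext m
    by_cases hm : ∃ c, e c = m
    · obtain ⟨c, rfl⟩ := hm
      simp only [p, he.extend_apply]
    · simp only [p, Function.extend_apply' _ _ _ hm]
      simp
  rw [hp]
  exact continuous_iInf_dom (i := p) continuous_induced_dom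

end SigmaWeak

namespace FockSpace

variable {ι : Type}

set_option synthInstance.maxHeartbeats 200000 in
noncomputable instance : SMul ℂ (boundedSupport ι) := inferInstance

noncomputable instance : AddCommMonoid (boundedSupport ι) := inferInstance

/-- A locally normal functional is continuous along nets in `𝔅_k` which are bounded and converge in
the weak operator topology. -/
theorem IsLocallyNormal.tendsto {ω : boundedSupport ι →ₗ[ℂ] ℂ} (hω : IsLocallyNormal ω)
    {α : Type*} {l : Filter α} {k : ℕ} {B : α → boundedSupport ι} {B₀ : boundedSupport ι}
    (hB : ∀ a, (B a : FockSpace ι →L[ℂ] FockSpace ι) ∈ supportedUpTo ι k)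
    (hB₀ : (B₀ : FockSpace ι →L[ℂ] FockSpace ι) ∈ supportedUpTo ι k) {C : ℝ}
    (hC : ∀ a, ‖(B a : FockSpace ι →L[ℂ] FockSpace ι)‖ ≤ C)
    (h : ∀ x y : FockSpace ι, Tendsto (fun a => ⟪y, (B a).1 x⟫_ℂ) l (𝓝 ⟪y, B₀.1 x⟫_ℂ)) :
    Tendsto (fun a => ω (B a)) l (𝓝 (ω B₀)) := by
  let _ := levelTopology ι k
  have hk := (hω k).tendsto ⟨B₀, hB₀⟩
  refine hk.comp (f := fun a => ⟨B a, hB a⟩) ?_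
  let _ := sigmaWeakTopology (FockSpace ι)
  rw [nhds_induced, tendsto_comap_iff, nhds_iInf, tendsto_iInf]
  intro p
  rw [nhds_induced, tendsto_comap_iff]
  exact tendsto_tsum_inner_apply p.2.1 p.2.2 hC h

/-- The orthogonal projection onto the span of finitely many basis vectors. -/
noncomputable def cutoff (s : Finset (List ι)) : FockSpace ι →L[ℂ] FockSpace ι :=
  ∑ μ ∈ s, InnerProductSpace.rankOne ℂ (basisVec μ) (basisVec μ)

theorem cutoff_apply (s : Finset (List ι)) (x : FockSpace ι) :
    cutoff s x = ∑ μ ∈ s, x μ • basisVec μ := by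
  simp [cutoff, InnerProductSpace.rankOne_apply, inner_basisVec]

theorem tendsto_cutoff (x : FockSpace ι) :
    Tendsto (fun s => cutoff s x) atTop (𝓝 x) := by
  simp only [cutoff_apply]
  exact hasSum_basisVec x

theorem norm_cutoff_le (s : Finset (List ι)) : ‖cutoff (ι := ι) s‖ ≤ 1 := by
  refine ContinuousLinearMap.opNorm_le_bound _ zero_le_one fun x => ?_
  rw [one_mul]
  refine (sq_le_sq₀ (norm_nonneg _) (norm_nonneg _)).1 ?_
  have h := (orthonormal_basisVec ι).sum_inner_products_le x (s := s)
  refine le_trans (le_of_eq ?_) h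
  have h2 := (orthonormal_basisVec ι).inner_sum (fun μ => x μ) (fun μ => x μ) s
  rw [← cutoff_apply] at h2
  have h3 := inner_self_eq_norm_sq_to_K (𝕜 := ℂ) (cutoff s x)
  rw [h2] at h3
  have h4 : ((‖cutoff s x‖ ^ 2 : ℝ) : ℂ) = ((∑ μ ∈ s, ‖x μ‖ ^ 2 : ℝ) : ℂ) := by
    push_cast
    rw [← Complex.coe_algebraMap, ← RCLike.algebraMap_eq_ofReal] at *
    rw [← h3]
    exact Finset.sum_congr rfl fun μ _ => by
      rw [mul_comm]; exact RCLike.mul_conj (x μ)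
  simp only [inner_basisVec]
  exact_mod_cast h4

theorem inner_cutoff (s : Finset (List ι)) (x y : FockSpace ι) :
    ⟪cutoff s x, y⟫_ℂ = ⟪x, cutoff s y⟫_ℂ := by
  simp only [cutoff_apply, sum_inner, inner_sum, inner_smul_left, inner_smul_right, inner_basisVec]
  refine Finset.sum_congr rfl fun μ _ => ?_
  rw [← inner_conj_symm x, inner_basisVec, mul_comm]

theorem tendsto_inner_cutoff_conj (T : FockSpace ι →L[ℂ] FockSpace ι) (x y : FockSpace ι) :
    Tendsto (fun s => ⟪y, (cutoff s * T * cutoff s : FockSpace ι →L[ℂ] FockSpace ι) x⟫_ℂ) atTop (𝓝 ⟪y, T x⟫_ℂ) := by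
  have h : ∀ s, ⟪y, (cutoff s * T * cutoff s : FockSpace ι →L[ℂ] FockSpace ι) x⟫_ℂ = ⟪cutoff s y, T (cutoff s x)⟫_ℂ := fun s => by
    rw [inner_cutoff]; rfl
  simp only [h]
  exact (tendsto_cutoff y).inner ((T.continuous.tendsto x).comp (tendsto_cutoff x))

theorem norm_cutoff_conj_le (T : FockSpace ι →L[ℂ] FockSpace ι) (s : Finset (List ι)) :
    ‖cutoff s * T * cutoff s‖ ≤ ‖T‖ := by
  calc _ ≤ ‖cutoff s‖ * ‖T‖ * ‖cutoff s‖ :=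
        (norm_mul_le _ _).trans (mul_le_mul_of_nonneg_right (norm_mul_le _ _) (norm_nonneg _))
    _ ≤ 1 * ‖T‖ * 1 := by gcongr <;> exact norm_cutoff_le s
    _ = _ := by ring

/-- The matrix entries of an operator. -/
noncomputable def entry (T : FockSpace ι →L[ℂ] FockSpace ι) (μ ν : List ι) : ℂ :=
  ⟪basisVec μ, T (basisVec ν)⟫_ℂ

/-- The finite matrix obtained from an operator by compression to finitely many basis vectors. -/
noncomputable def truncate (T : FockSpace ι →L[ℂ] FockSpace ι) (s : Finset (List ι)) :
    boundedSupport ι :=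
  ∑ μ ∈ s, ∑ ν ∈ s, (entry T μ ν • rankOneB μ ν : boundedSupport ι)

theorem coe_truncate (T : FockSpace ι →L[ℂ] FockSpace ι) (s : Finset (List ι)) :
    (truncate T s : FockSpace ι →L[ℂ] FockSpace ι) = cutoff s * T * cutoff s := by
  ext1 x
  have h1 : (truncate T s : FockSpace ι →L[ℂ] FockSpace ι) =
      ∑ μ ∈ s, ∑ ν ∈ s, entry T μ ν • InnerProductSpace.rankOne ℂ (basisVec μ) (basisVec ν) := by
    rw [truncate, AddSubmonoidClass.coe_finsetSum]
    refine Finset.sum_congr rfl fun μ _ => ?_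
    rw [AddSubmonoidClass.coe_finsetSum]
    rfl
  rw [h1, mul_apply_eq_comp, mul_apply_eq_comp, cutoff_apply s (T _)]
  simp only [sum_apply]
  refine Finset.sum_congr rfl fun μ _ => ?_
  rw [← inner_basisVec, cutoff_apply, map_sum, inner_sum, Finset.sum_smul]
  refine Finset.sum_congr rfl fun ν _ => ?_
  rw [smul_apply, InnerProductSpace.rankOne_apply, map_smul, inner_smul_right,
    inner_basisVec, smul_smul, mul_comm, entry]

/-- Both are diagonal in the word basis. Truncation therefore stays inside a fixed 𝔅_k, where
normality applies. -/
theorem proj_mul_cutoff (k : ℕ) (s : Finset (List ι)) :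
    proj ι k * cutoff s = cutoff s * proj ι k := by
  classical
  refine ext_basisVec fun μ => ?_
  have hc : cutoff s (basisVec μ) = if μ ∈ s then basisVec μ else (0 : FockSpace ι) := by
    rw [cutoff_apply]
    simp [basisVec_apply, ite_smul]
  rw [mul_apply_eq_comp, mul_apply_eq_comp]
  by_cases hμ : μ.length ≤ k
  · rw [proj_basisVec_of_le hμ, hc]
    split_ifs
    · exact proj_basisVec_of_le hμ
    · exact map_zero _
  · push Not at hμ
    rw [proj_basisVec_of_lt hμ, hc, map_zero]
    split_ifs
    · exact proj_basisVec_of_lt hμ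
    · exact map_zero _

theorem truncate_mem {k : ℕ} {T : FockSpace ι →L[ℂ] FockSpace ι} (hT : T ∈ supportedUpTo ι k)
    (s : Finset (List ι)) :
    (truncate T s : FockSpace ι →L[ℂ] FockSpace ι) ∈ supportedUpTo ι k := by
  rw [mem_supportedUpTo] at *
  rw [coe_truncate]
  calc _ = (proj ι k * cutoff s) * T * (cutoff s * proj ι k) := by simp only [mul_assoc]
    _ = (cutoff s * proj ι k) * T * (proj ι k * cutoff s) := by rw [proj_mul_cutoff]
    _ = cutoff s * (proj ι k * T * proj ι k) * cutoff s := by simp only [mul_assoc]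
    _ = _ := by rw [hT]

theorem IsLocallyNormal.tendsto_truncate {ω : boundedSupport ι →ₗ[ℂ] ℂ} (hω : IsLocallyNormal ω)
    (B : boundedSupport ι) : Tendsto (fun s => ω (truncate B.1 s)) atTop (𝓝 (ω B)) := by
  obtain ⟨k, hk⟩ := B.2
  refine hω.tendsto (truncate_mem hk) hk (C := ‖B.1‖) (fun s => ?_) fun x y => ?_
  · rw [coe_truncate]; exact norm_cutoff_conj_le _ _
  · simp only [coe_truncate]; exact tendsto_inner_cutoff_conj _ _ _

/-- A locally normal functional is determined by its values on the `|v_μ⟩⟨v_ν|`. -/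
theorem IsLocallyNormal.ext {ω₁ ω₂ : boundedSupport ι →ₗ[ℂ] ℂ} (h₁ : IsLocallyNormal ω₁)
    (h₂ : IsLocallyNormal ω₂) (h : ∀ μ ν, ω₁ (rankOneB μ ν) = ω₂ (rankOneB μ ν)) : ω₁ = ω₂ := by
  refine LinearMap.ext fun B => tendsto_nhds_unique (h₁.tendsto_truncate B) ?_
  convert h₂.tendsto_truncate B using 2 with s
  simp only [truncate, map_sum, map_smul, h]

theorem IsLocallyNormal.sub {ω₁ ω₂ : boundedSupport ι →ₗ[ℂ] ℂ} (h₁ : IsLocallyNormal ω₁)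
    (h₂ : IsLocallyNormal ω₂) : IsLocallyNormal (ω₁ - ω₂) := fun k => by
  let _ := levelTopology ι k
  exact (h₁ k).sub (h₂ k)

end FockSpace

end

-- The shift and products B⋆B under locally normal functionals

section

open Filter Topology

namespace FockSpace

variable {ι : Type}

/-- The operator `r(v_i) A r(v_i)⋆`. -/
noncomputable def rightConj (i : ι) (A : FockSpace ι →L[ℂ] FockSpace ι) :
    FockSpace ι →L[ℂ] FockSpace ι :=
  (rightCreation i).toContinuousLinearMap * A * star (rightCreation i).toContinuousLinearMap

theorem hasSum_rightConj (A : FockSpace ι →L[ℂ] FockSpace ι) (x : FockSpace ι) :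
    HasSum (fun i => rightConj i A x) (shift A x) :=
  hasSum_shift A x

theorem rightConj_mem {k : ℕ} {T : FockSpace ι →L[ℂ] FockSpace ι} (hT : T ∈ supportedUpTo ι k)
    (i : ι) : rightConj i T ∈ supportedUpTo ι (k + 1) := by
  have h : proj ι (k + 1) * (rightCreation i).toContinuousLinearMap =
      (rightCreation i).toContinuousLinearMap * proj ι k := by
    ext1 y; exact proj_succ_rightCreation k i y
  have h' := congrArg star h
  rw [star_mul, star_mul, star_proj, star_proj] at h'
  rw [mem_supportedUpTo] at *
  rw [rightConj]
  calc _ = (proj ι (k + 1) * (rightCreation i).toContinuousLinearMap) * T *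
        (star (rightCreation i).toContinuousLinearMap * proj ι (k + 1)) := by
          simp only [mul_assoc]
    _ = (rightCreation i).toContinuousLinearMap * (proj ι k * T * proj ι k) *
        star (rightCreation i).toContinuousLinearMap := by
          rw [h, h']; simp only [mul_assoc]
    _ = _ := by rw [hT]

/-- The map `A ↦ r(v_i) A r(v_i)⋆` on `𝔅`. -/
noncomputable def rightConjB (i : ι) : boundedSupport ι →ₗ[ℂ] boundedSupport ι where
  toFun T := ⟨rightConj i T, T.2.elim fun k hk => ⟨k + 1, rightConj_mem hk i⟩⟩
  map_add' S T := Subtype.ext <| by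
    change rightConj i (S.1 + T.1) = rightConj i S.1 + rightConj i T.1
    simp only [rightConj, mul_add, add_mul]
  map_smul' c T := Subtype.ext <| by
    change rightConj i (c • T.1) = c • rightConj i T.1
    simp only [rightConj, mul_smul_comm, smul_mul_assoc]

theorem rightConjB_rankOneB (i : ι) (μ ν : List ι) :
    rightConjB i (rankOneB μ ν) = rankOneB (μ ++ [i]) (ν ++ [i]) := by
  refine Subtype.ext ?_
  change rightConj i (InnerProductSpace.rankOne ℂ (basisVec μ) (basisVec ν)) =
    InnerProductSpace.rankOne ℂ (basisVec (μ ++ [i])) (basisVec (ν ++ [i]))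
  ext1 x
  have h := ContinuousLinearMap.adjoint_inner_right (rightCreation i).toContinuousLinearMap
    (basisVec ν) x
  rw [LinearIsometry.coe_toContinuousLinearMap, rightCreation_basisVec] at h
  rw [InnerProductSpace.rankOne_apply, ← h, ← rightCreation_basisVec, ← map_smul]
  rfl

theorem norm_sum_rightConj_le (t : Finset ι) (A : FockSpace ι →L[ℂ] FockSpace ι) :
    ‖∑ i ∈ t, rightConj i A‖ ≤ ‖A‖ := by
  refine ContinuousLinearMap.opNorm_le_bound _ (norm_nonneg _) fun x => ?_
  refine (sq_le_sq₀ (norm_nonneg _) (by positivity)).1 ?_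
  rw [sum_apply, mul_pow]
  refine le_trans (le_of_eq ?_) (sum_norm_shift_sq_le A x t)
  exact (orthogonalFamily_rightCreation ι).norm_sum
    (fun i => A (ContinuousLinearMap.adjoint (rightCreation i).toContinuousLinearMap x)) t

/-- The partial sums of β(B) lie in one 𝔅_{k+1}, are bounded by ‖B‖ because the r(v_i) have
orthogonal ranges, and converge strongly; so ω may be applied term by term even for infinitely many
generators. -/
theorem IsLocallyNormal.hasSum_rightConjB {ω : boundedSupport ι →ₗ[ℂ] ℂ} (hω : IsLocallyNormal ω)
    (B : boundedSupport ι) : HasSum (fun i => ω (rightConjB i B)) (ω (shiftB ι B)) := by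
  obtain ⟨k, hk⟩ := B.2
  have hcoe : ∀ t : Finset ι, ((∑ i ∈ t, rightConjB i B : boundedSupport ι) :
      FockSpace ι →L[ℂ] FockSpace ι) = ∑ i ∈ t, rightConj i B.1 := fun t => by
    rw [AddSubmonoidClass.coe_finsetSum]
    rfl
  have h := hω.tendsto (l := atTop) (B := fun t => ∑ i ∈ t, rightConjB i B) (B₀ := shiftB ι B)
    (k := k + 1) (fun t => ?_) (shift_mem hk) (C := ‖B.1‖) (fun t => ?_) fun x y => ?_
  · simp only [map_sum] at h
    exact h
  · rw [hcoe]
    exact sum_mem fun i _ => rightConj_mem hk i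
  · rw [hcoe]
    exact norm_sum_rightConj_le t B.1
  · have := (hasSum_rightConj B.1 x).mapL (innerSL ℂ y)
    simp only [innerSL_apply_apply] at this
    refine Tendsto.congr (fun t => ?_) this
    rw [hcoe, sum_apply, inner_sum]

theorem norm_shift_le (A : FockSpace ι →L[ℂ] FockSpace ι) : ‖shift A‖ ≤ ‖A‖ :=
  LinearMap.mkContinuous_norm_le _ (norm_nonneg _) _

/-- `β` is continuous along bounded nets which converge in the weak operator topology. -/
theorem tendsto_inner_shift {α : Type*} {l : Filter α} {T : α → FockSpace ι →L[ℂ] FockSpace ι}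
    {T₀ : FockSpace ι →L[ℂ] FockSpace ι} {C : ℝ} (hC : ∀ a, ‖T a‖ ≤ C)
    (hT : ∀ x y : FockSpace ι, Tendsto (fun a => ⟪y, T a x⟫_ℂ) l (𝓝 ⟪y, T₀ x⟫_ℂ))
    (x y : FockSpace ι) :
    Tendsto (fun a => ⟪y, shift (T a) x⟫_ℂ) l (𝓝 ⟪y, shift T₀ x⟫_ℂ) := by
  have hs : ∀ z : FockSpace ι, Summable fun i =>
      ‖ContinuousLinearMap.adjoint (rightCreation i).toContinuousLinearMap z‖ ^ 2 := fun z =>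
    summable_of_sum_le (fun _ => by positivity) fun t => sum_norm_adjoint_sq_le t z
  -- Moving each r(v_i) across the inner product gives a σ-weak functional of A, with the
  -- square-summable families r(v_i)⋆x and r(v_i)⋆y.
  have hsum : ∀ A : FockSpace ι →L[ℂ] FockSpace ι, ⟪y, shift A x⟫_ℂ =
      ∑' i, ⟪ContinuousLinearMap.adjoint (rightCreation i).toContinuousLinearMap y,
        A (ContinuousLinearMap.adjoint (rightCreation i).toContinuousLinearMap x)⟫_ℂ := by
    intro A
    refine HasSum.unique ((hasSum_shift A x).mapL (innerSL ℂ y)) ?_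
    simp only [innerSL_apply_apply]
    rw [show (fun i => ⟪y, rightCreation i (A (ContinuousLinearMap.adjoint
        (rightCreation i).toContinuousLinearMap x))⟫_ℂ) = _ from funext fun i =>
      (ContinuousLinearMap.adjoint_inner_left (rightCreation i).toContinuousLinearMap _ _).symm]
    exact (summable_inner_apply (hs x) (hs y) A).hasSum
  simp only [hsum]
  exact tendsto_tsum_inner_apply (hs x) (hs y) hC hT

theorem star_rankOneB (μ ν : List ι) : star (rankOneB μ ν) = rankOneB ν μ :=
  Subtype.ext (InnerProductSpace.adjoint_rankOne _ _)

theorem rankOneB_mul_rankOneB [DecidableEq ι] (μ ν κ l : List ι) :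
    rankOneB μ ν * rankOneB κ l = if ν = κ then rankOneB μ l else 0 := by
  classical
  refine Subtype.ext ?_
  have h : (InnerProductSpace.rankOne ℂ (basisVec μ : FockSpace ι) (basisVec ν)) *
      (InnerProductSpace.rankOne ℂ (basisVec κ : FockSpace ι) (basisVec l)) =
      if ν = κ then InnerProductSpace.rankOne ℂ (basisVec μ) (basisVec l) else 0 := by
    ext1 x
    rw [mul_apply_eq_comp, InnerProductSpace.rankOne_apply, InnerProductSpace.rankOne_apply,
      inner_smul_right, orthonormal_iff_ite.1 (orthonormal_basisVec ι)]
    split_ifs <;> simp [InnerProductSpace.rankOne_apply]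
  refine h.trans ?_
  split_ifs <;> rfl

theorem star_truncate_mul_truncate (T : FockSpace ι →L[ℂ] FockSpace ι) (s : Finset (List ι)) :
    star (truncate T s) * truncate T s = ∑ κ ∈ s, ∑ μ ∈ s, ∑ ν ∈ s,
      (starRingEnd ℂ (entry T κ μ) * entry T κ ν) • (rankOneB μ ν : boundedSupport ι) := by
  classical
  simp only [truncate, star_sum, star_smul, star_rankOneB, Finset.sum_mul, Finset.mul_sum,
    smul_mul_smul_comm, rankOneB_mul_rankOneB, smul_ite, smul_zero]
  refine Finset.sum_congr rfl fun κ hκ => Eq.trans ?_ Finset.sum_comm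
  refine Finset.sum_congr rfl fun μ _ => ?_
  rw [Finset.sum_comm]
  refine Finset.sum_congr rfl fun ν _ => ?_
  simp [hκ]

theorem coe_star_truncate_mul_truncate (T : FockSpace ι →L[ℂ] FockSpace ι)
    (s : Finset (List ι)) :
    ((star (truncate T s) * truncate T s : boundedSupport ι) :
      FockSpace ι →L[ℂ] FockSpace ι) = star (cutoff s * T * cutoff s) * (cutoff s * T * cutoff s) := by
  rw [← coe_truncate]; rfl

theorem norm_star_truncate_mul_truncate_le (T : FockSpace ι →L[ℂ] FockSpace ι)
    (s : Finset (List ι)) :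
    ‖((star (truncate T s) * truncate T s : boundedSupport ι) :
      FockSpace ι →L[ℂ] FockSpace ι)‖ ≤ ‖T‖ * ‖T‖ := by
  rw [coe_star_truncate_mul_truncate]
  refine (norm_mul_le _ _).trans ?_
  have h : ‖star (cutoff s * T * cutoff s)‖ = ‖cutoff s * T * cutoff s‖ :=
    ContinuousLinearMap.adjoint.norm_map _
  rw [h]
  gcongr <;> exact norm_cutoff_conj_le T s

/-- Strong convergence is needed here: weak convergence of the truncations T_s would not give weak
convergence of T_s⋆ T_s. -/
theorem tendsto_cutoff_conj (T : FockSpace ι →L[ℂ] FockSpace ι) (x : FockSpace ι) :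
    Tendsto (fun s => (cutoff s * T * cutoff s : FockSpace ι →L[ℂ] FockSpace ι) x) atTop
      (𝓝 (T x)) := by
  have h1 : Tendsto (fun s => cutoff s (T x)) atTop (𝓝 (T x)) := tendsto_cutoff (T x)
  have h2 : Tendsto (fun s => cutoff s (T (cutoff s x - x))) atTop (𝓝 0) := by
    refine squeeze_zero_norm (a := fun s => ‖T‖ * ‖cutoff s x - x‖) (fun s => ?_) ?_
    · calc _ ≤ 1 * ‖T (cutoff s x - x)‖ := (cutoff s).le_of_opNorm_le (norm_cutoff_le s) _
        _ ≤ _ := by rw [one_mul]; exact T.le_opNorm _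
    · have := (tendsto_iff_norm_sub_tendsto_zero.1 (tendsto_cutoff x)).const_mul ‖T‖
      rwa [mul_zero] at this
  have h3 := h1.add h2
  rw [add_zero] at h3
  refine h3.congr fun s => ?_
  rw [← map_add, ← map_add, add_sub_cancel]
  rfl

theorem tendsto_inner_star_truncate_mul_truncate (T : FockSpace ι →L[ℂ] FockSpace ι)
    (x y : FockSpace ι) :
    Tendsto (fun s => ⟪y, ((star (truncate T s) * truncate T s : boundedSupport ι) :
      FockSpace ι →L[ℂ] FockSpace ι) x⟫_ℂ) atTop (𝓝 ⟪y, (star T * T) x⟫_ℂ) := by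
  have h : ∀ A : FockSpace ι →L[ℂ] FockSpace ι, ⟪y, (star A * A) x⟫_ℂ = ⟪A y, A x⟫_ℂ :=
    fun A => ContinuousLinearMap.adjoint_inner_right A y (A x)
  simp only [coe_star_truncate_mul_truncate, h]
  exact (tendsto_cutoff_conj T y).inner (tendsto_cutoff_conj T x)

end FockSpace

namespace ToeplitzCuntz

variable {ι : Type}

/-- `1 - ∑ v_μ v_μ⋆`, the sum over finitely many words of the same length, is a projection. -/
theorem star_one_sub_sum_mul_self (t : Finset (List ι)) (k : ℕ) (ht : ∀ μ ∈ t, μ.length = k) :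
    star (1 - ∑ μ ∈ t, word μ * star (word μ)) * (1 - ∑ μ ∈ t, word μ * star (word μ)) =
      1 - ∑ μ ∈ t, word μ * star (word μ) := by
  classical
  set q : ToeplitzCuntz ι := ∑ μ ∈ t, word μ * star (word μ) with hq
  have hs : star q = q := by simp [hq, star_sum]
  have hqq : q * q = q := by
    rw [hq, Finset.sum_mul_sum]
    refine Finset.sum_congr rfl fun μ hμ => ?_
    rw [Finset.sum_eq_single_of_mem μ hμ]
    · have := star_word_mul_word μ μ rfl
      rw [if_pos rfl] at this
      rw [mul_assoc, ← mul_assoc (star (word μ)), this, one_mul]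
    · intro ν hν hne
      have := star_word_mul_word ν μ ((ht ν hν).trans (ht μ hμ).symm)
      rw [if_neg hne] at this
      rw [mul_assoc, ← mul_assoc (star (word μ)), this, zero_mul, mul_zero]
  rw [star_sub, star_one, hs, mul_sub, sub_mul, one_mul, mul_one, sub_mul, one_mul, hqq, sub_self,
    sub_zero]

/-- With the projection q = ∑ v_μ v_μ⋆, the difference of the two sides is ρ(y⋆y) for y = (1 - q)x⋆.
Words of length one yield the decreasing property, longer ones the trace bound. -/
theorem sum_apply_conj_word_le {ρ : ToeplitzCuntz ι →ₗ[ℂ] ℂ} (hρ : IsPositiveFunctional ρ)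
    (t : Finset (List ι)) (k : ℕ) (ht : ∀ μ ∈ t, μ.length = k) (x : ToeplitzCuntz ι) :
    ∑ μ ∈ t, ρ (x * word μ * star (x * word μ)) ≤ ρ (x * star x) := by
  rw [← sub_nonneg]
  have h := hρ ((1 - ∑ μ ∈ t, word μ * star (word μ)) * star x)
  rw [star_mul, star_star, mul_assoc, ← mul_assoc (star (1 - _)),
    star_one_sub_sum_mul_self t k ht] at h
  convert h using 1
  simp only [mul_sub, sub_mul, one_mul, map_sub, Finset.sum_mul, Finset.mul_sum, map_sum, star_mul,
    mul_assoc]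

end ToeplitzCuntz

-- Positivity and decrease of ω inherited from ρ

namespace FockSpace

open ToeplitzCuntz

variable {ι : Type}

/-- A locally normal functional which comes from a positive functional on the Toeplitz-Cuntz algebra
is positive and decreasing. -/
theorem IsLocallyNormal.mem_decreasingCone {ω : boundedSupport ι →ₗ[ℂ] ℂ} (hω : IsLocallyNormal ω)
    {ρ : ToeplitzCuntz ι →ₗ[ℂ] ℂ} (hρ : IsPositiveFunctional ρ)
    (h : ∀ μ ν, ρ (word μ * star (word ν)) = ω (rankOneB μ ν)) : ω ∈ decreasingCone ι := by
  have hρ' : ∀ x, 0 ≤ ρ (x * star x) := fun x => by simpa using hρ (star x)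
  -- Here κ = [] computes ω itself, and κ = [i] computes ω after conjugation by r(v_i), which
  -- appends i to both words.
  have key : ∀ (z : List ι → ℂ) (s : Finset (List ι)) (κ : List ι),
      ∑ μ ∈ s, ∑ ν ∈ s, (starRingEnd ℂ (z μ) * z ν) * ω (rankOneB (μ ++ κ) (ν ++ κ)) =
      ρ ((∑ μ ∈ s, starRingEnd ℂ (z μ) • word μ) * word κ *
        star ((∑ μ ∈ s, starRingEnd ℂ (z μ) • word μ) * word κ)) := by
    intro z s κ
    simp only [Finset.sum_mul, star_sum, Finset.mul_sum, map_sum, smul_mul_assoc, star_smul,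
      mul_smul_comm, map_smul, smul_eq_mul, ← word_append, h]
    rw [Finset.sum_comm]
    refine Finset.sum_congr rfl fun μ _ => Finset.sum_congr rfl fun ν _ => ?_
    simp
    ring
  -- Row κ of the truncated matrix, conjugated and read as an element of the algebra, so that B⋆B
  -- corresponds to ∑ X_κ X_κ⋆.
  let X : boundedSupport ι → Finset (List ι) → List ι → ToeplitzCuntz ι := fun B s κ =>
    ∑ μ ∈ s, starRingEnd ℂ (entry B.1 κ μ) • word μ
  have hval : ∀ (B : boundedSupport ι) s, ω (star (truncate B.1 s) * truncate B.1 s) =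
      ∑ κ ∈ s, ρ (X B s κ * star (X B s κ)) := by
    intro B s
    simp only [star_truncate_mul_truncate, map_sum, map_smul, smul_eq_mul]
    refine Finset.sum_congr rfl fun κ _ => ?_
    have := key (entry B.1 κ) s []
    simp only [List.append_nil, show word ([] : List ι) = 1 from rfl, mul_one] at this
    exact this
  have hconj : ∀ (B : boundedSupport ι) s i,
      ω (rightConjB i (star (truncate B.1 s) * truncate B.1 s)) =
      ∑ κ ∈ s, ρ (X B s κ * word [i] * star (X B s κ * word [i])) := by
    intro B s i
    simp only [star_truncate_mul_truncate, map_sum, map_smul, smul_eq_mul, rightConjB_rankOneB]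
    exact Finset.sum_congr rfl fun κ _ => key (entry B.1 κ) s [i]
  -- Row by row this is ∑ X v_i v_i⋆ X⋆ ≤ X X⋆ under ρ, for each finite set of generators.
  have hdec : ∀ (B : boundedSupport ι) s,
      ω (shiftB ι (star (truncate B.1 s) * truncate B.1 s)) ≤
        ω (star (truncate B.1 s) * truncate B.1 s) := by
    intro B s
    refine le_of_tendsto (hω.hasSum_rightConjB _) (Eventually.of_forall fun t => ?_)
    rw [hval]
    simp only [hconj]
    rw [Finset.sum_comm]
    refine Finset.sum_le_sum fun κ _ => ?_
    have := sum_apply_conj_word_le hρ (t.map ⟨fun i => [i], List.singleton_injective⟩) 1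
      (by simp) (X B s κ)
    simpa using this
  have hlim : ∀ B : boundedSupport ι,
      Tendsto (fun s => ω (star (truncate B.1 s) * truncate B.1 s)) atTop (𝓝 (ω (star B * B))) ∧
      Tendsto (fun s => ω (shiftB ι (star (truncate B.1 s) * truncate B.1 s))) atTop
        (𝓝 (ω (shiftB ι (star B * B)))) := by
    intro B
    obtain ⟨k, hk⟩ := B.2
    have hm : ∀ s, ((star (truncate B.1 s) * truncate B.1 s : boundedSupport ι) :
        FockSpace ι →L[ℂ] FockSpace ι) ∈ supportedUpTo ι k := fun s =>
      mul_mem (star_mem (truncate_mem hk s)) (truncate_mem hk s)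
    have hm0 : ((star B * B : boundedSupport ι) : FockSpace ι →L[ℂ] FockSpace ι) ∈
        supportedUpTo ι k := mul_mem (star_mem hk) hk
    refine ⟨hω.tendsto hm hm0 (norm_star_truncate_mul_truncate_le B.1)
      (tendsto_inner_star_truncate_mul_truncate B.1),
      hω.tendsto (fun s => shift_mem (hm s)) (shift_mem hm0)
        (fun s => (norm_shift_le _).trans (norm_star_truncate_mul_truncate_le B.1 s))
        (tendsto_inner_shift (norm_star_truncate_mul_truncate_le B.1)
          (tendsto_inner_star_truncate_mul_truncate B.1))⟩
  refine ⟨fun B => ge_of_tendsto (hlim B).1 (Eventually.of_forall fun s => ?_), fun B =>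
    sub_nonneg.2 (le_of_tendsto_of_tendsto (hlim B).2 (hlim B).1
      (Eventually.of_forall fun s => hdec B s))⟩
  rw [hval]
  exact Finset.sum_nonneg fun κ _ => hρ' _

end FockSpace

end

section

open Filter Topology

/-! ### From functionals on the Toeplitz-Cuntz algebra to locally normal functionals -/

namespace FockSpace

open ToeplitzCuntz

variable {ι : Type}

instance : Nontrivial (ToeplitzCuntz ι) := (fockRep ι).toRingHom.domain_nontrivial

theorem norm_sq_sum_basisVec (z : List ι → ℂ) (s : Finset (List ι)) :
    ‖∑ μ ∈ s, z μ • (basisVec μ : FockSpace ι)‖ ^ 2 = ∑ μ ∈ s, ‖z μ‖ ^ 2 :=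
  (orthonormal_basisVec ι).orthogonalFamily.norm_sum z s

/-- For words of one length, f⋆f is the scalar ∑ |z_μ|², so the C*-norm is the Hilbert space norm.
This fails for mixed lengths, which is why the embedding is built degree by degree. -/
theorem norm_sq_sum_word_le (z : List ι → ℂ) (s : Finset (List ι)) (k : ℕ)
    (hs : ∀ μ ∈ s, μ.length = k) :
    ‖∑ μ ∈ s, z μ • (word μ : ToeplitzCuntz ι)‖ ^ 2 ≤ ∑ μ ∈ s, ‖z μ‖ ^ 2 := by
  classical
  have h : star (∑ μ ∈ s, z μ • (word μ : ToeplitzCuntz ι)) * (∑ μ ∈ s, z μ • word μ) =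
      ((∑ μ ∈ s, ‖z μ‖ ^ 2 : ℝ) : ℂ) • 1 := by
    rw [star_sum, Finset.sum_mul_sum, Complex.ofReal_sum, Finset.sum_smul]
    refine Finset.sum_congr rfl fun μ hμ => ?_
    rw [Finset.sum_eq_single_of_mem μ hμ]
    · rw [star_smul, smul_mul_smul_comm, star_word_mul_word μ μ rfl, if_pos rfl]
      congr 1
      rw [Complex.ofReal_pow]
      exact RCLike.conj_mul (z μ)
    · intro ν hν hne
      rw [star_smul, smul_mul_smul_comm, star_word_mul_word ν μ ((hs ν hν).trans (hs μ hμ).symm),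
        if_neg hne, smul_zero]
  rw [sq, ← CStarRing.norm_star_mul_self, h, norm_smul, CStarRing.norm_one, mul_one,
    Complex.norm_real, Real.norm_of_nonneg (Finset.sum_nonneg fun _ _ => by positivity)]

theorem exists_fiberMap (ι : Type) (j : ℕ) : ∃ L : FockSpace ι →L[ℂ] ToeplitzCuntz ι,
    ∀ μ, L (basisVec μ) = if μ.length = j then word μ else 0 := by
  classical
  let e : (List ι →₀ ℂ) →ₗ[ℂ] FockSpace ι := Finsupp.linearCombination ℂ basisVec
  let f : (List ι →₀ ℂ) →ₗ[ℂ] ToeplitzCuntz ι :=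
    Finsupp.linearCombination ℂ fun μ => if μ.length = j then word μ else 0
  have hdense : DenseRange e := fun x =>
    mem_closure_of_tendsto (hasSum_basisVec x) <| Eventually.of_forall fun s =>
      ⟨∑ μ ∈ s, Finsupp.single μ (x μ), by simp [e, map_sum]⟩
  have hnorm : ∀ z, ‖f z‖ ≤ 1 * ‖e z‖ := by
    intro z
    rw [one_mul]
    refine (sq_le_sq₀ (norm_nonneg _) (norm_nonneg _)).1 ?_
    have hf : f z = ∑ μ ∈ z.support with μ.length = j, z μ • word μ := by
      simp only [f, Finsupp.linearCombination_apply, Finsupp.sum, Finset.sum_filter, smul_ite,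
        smul_zero]
    have he : e z = ∑ μ ∈ z.support, z μ • basisVec μ := by
      simp only [e, Finsupp.linearCombination_apply, Finsupp.sum]
    rw [hf, he, norm_sq_sum_basisVec]
    refine (norm_sq_sum_word_le z _ j (by simp)).trans ?_
    exact Finset.sum_le_sum_of_subset_of_nonneg (Finset.filter_subset _ _)
      fun _ _ _ => by positivity
  refine ⟨f.extendOfNorm e, fun μ => ?_⟩
  have h1 : e (Finsupp.single μ 1) = basisVec μ := by simp [e]
  rw [← h1, LinearMap.extendOfNorm_eq hdense ⟨1, hnorm⟩]
  simp [f]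

/-- The embedding of `⨁_{j ≤ k} ℰ_j` into the Toeplitz-Cuntz algebra. -/
theorem exists_wordMap (ι : Type) (k : ℕ) : ∃ L : FockSpace ι →L[ℂ] ToeplitzCuntz ι,
    ∀ μ, L (basisVec μ) = if μ.length ≤ k then word μ else 0 := by
  choose L hL using exists_fiberMap ι
  refine ⟨∑ j ∈ Finset.range (k + 1), L j, fun μ => ?_⟩
  simp [sum_apply, hL]

/-- Each of the k + 1 lengths 0, …, k contributes at most ρ(1). This is the trace bound behind
normality. -/
theorem sum_apply_word_le {ρ : ToeplitzCuntz ι →ₗ[ℂ] ℂ} (hρ : IsPositiveFunctional ρ) (k : ℕ)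
    (s : Finset (List ι)) :
    ∑ μ ∈ s with μ.length ≤ k, (ρ (word μ * star (word μ))).re ≤ (k + 1) * (ρ 1).re := by
  classical
  have hfib := Finset.sum_fiberwise_of_maps_to (s := s.filter fun μ => μ.length ≤ k)
    (t := Finset.range (k + 1)) (g := List.length) (fun μ hμ => by
      simpa [Nat.lt_succ_iff] using (Finset.mem_filter.1 hμ).2)
    (fun μ => (ρ (word μ * star (word μ))).re)
  rw [← hfib]
  refine (Finset.sum_le_card_nsmul _ _ (ρ 1).re fun j _ => ?_).trans (by simp)
  have h := sum_apply_conj_word_le hρ ((s.filter fun μ => μ.length ≤ k).filter fun μ => μ.length = j)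
    j (fun μ hμ => (Finset.mem_filter.1 hμ).2) 1
  have := (Complex.le_def.1 h).1
  simpa using this

/-- A positive functional on the Toeplitz-Cuntz algebra is represented on the words of length at most
`k` by a square-summable family of vectors of Fock space. -/
theorem exists_summable_family {ρ : StrongDual ℂ (ToeplitzCuntz ι)}
    (hρ : ρ ∈ positiveDual (ToeplitzCuntz ι)) (k : ℕ) :
    ∃ u : List ι → FockSpace ι, (Summable fun κ => ‖u κ‖ ^ 2) ∧
      ∀ μ ν : List ι, μ.length ≤ k → ν.length ≤ k →
        HasSum (fun κ => ⟪u κ, basisVec μ⟫_ℂ * ⟪basisVec ν, u κ⟫_ℂ)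
          (ρ (word μ * star (word ν))) := by
  classical
  obtain ⟨L, hL⟩ := exists_wordMap ι k
  have hρ' : ∀ x, 0 ≤ ρ (x * star x) := fun x => by
    have := hρ (star x)
    rwa [star_star] at this
  let b : FockSpace ι →L⋆[ℂ] FockSpace ι →L[ℂ] ℂ := LinearMap.mkContinuous₂
    (LinearMap.mk₂'ₛₗ (starRingEnd ℂ) (RingHom.id ℂ) (fun y x => ρ (L x * star (L y)))
      (fun y y' x => by simp [mul_add]) (fun c y x => by simp)
      (fun y x x' => by simp [add_mul]) (fun c y x => by simp))
    (‖ρ‖ * (‖L‖ * ‖L‖)) fun y x => by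
      calc ‖ρ (L x * star (L y))‖ ≤ ‖ρ‖ * ‖L x * star (L y)‖ := ρ.le_opNorm _
        _ ≤ ‖ρ‖ * (‖L x‖ * ‖L y‖) := by
          gcongr
          exact (norm_mul_le _ _).trans (by rw [norm_star])
        _ ≤ ‖ρ‖ * ((‖L‖ * ‖x‖) * (‖L‖ * ‖y‖)) := by gcongr <;> exact L.le_opNorm _
        _ = _ := by ring
  let K : FockSpace ι →L[ℂ] FockSpace ι := InnerProductSpace.continuousLinearMapOfBilin b
  have hK : ∀ y x, ⟪K y, x⟫_ℂ = ρ (L x * star (L y)) := fun y x =>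
    InnerProductSpace.continuousLinearMapOfBilin_apply b y x
  have hK0 : 0 ≤ K := by
    rw [ContinuousLinearMap.nonneg_iff_isPositive, ContinuousLinearMap.isPositive_iff_complex]
    intro x
    rw [hK]
    obtain ⟨h1, h2⟩ := Complex.nonneg_iff.1 (hρ' (L x))
    exact ⟨Complex.ext rfl (by simpa using h2), h1⟩
  obtain ⟨S, hS0, hSS⟩ := CStarAlgebra.exists_nonneg_mul_self hK0
  have hSsymm : ∀ x y : FockSpace ι, ⟪S x, y⟫_ℂ = ⟪x, S y⟫_ℂ :=
    ((ContinuousLinearMap.nonneg_iff_isPositive S).1 hS0).inner_left_eq_inner_right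
  have hSK : ∀ y x, ⟪S y, S x⟫_ℂ = ρ (L x * star (L y)) := fun y x => by
    rw [← hSsymm, ← hK, ← hSS]; rfl
  -- S is the square root of the operator K of the form ρ(Lx (Ly)⋆). The trace bound on K makes S
  -- Hilbert-Schmidt, and Parseval's identity for ⟨S v_ν, S v_μ⟩ gives the series.
  refine ⟨fun κ => S (basisVec κ), ?_, fun μ ν hμ hν => ?_⟩
  · refine summable_of_sum_le (c := (k + 1) * (ρ 1).re) (fun _ => by positivity) fun s => ?_
    refine le_trans (le_of_eq ?_) (sum_apply_word_le hρ k s)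
    rw [Finset.sum_filter]
    refine Finset.sum_congr rfl fun κ _ => ?_
    have h := hSK (basisVec κ) (basisVec κ)
    rw [inner_self_eq_norm_sq_to_K, hL] at h
    have h2 := congrArg Complex.re h
    rw [← RCLike.ofReal_pow] at h2
    refine (Complex.ofReal_re _).symm.trans (h2.trans ?_)
    split_ifs <;> simp
  · have h := hSK (basisVec ν) (basisVec μ)
    rw [hL, hL, if_pos hμ, if_pos hν] at h
    rw [← h]
    have hs := (hasSum_basisVec (S (basisVec μ))).mapL (innerSL ℂ (S (basisVec ν)))
    simp only [innerSL_apply_apply, inner_smul_right] at hs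
    have hterm : (fun κ => ⟪S (basisVec κ), basisVec μ⟫_ℂ * ⟪basisVec ν, S (basisVec κ)⟫_ℂ) =
        fun κ => S (basisVec μ) κ * ⟪S (basisVec ν), basisVec κ⟫_ℂ := funext fun κ => by
      rw [← inner_basisVec, hSsymm, hSsymm]
    rw [hterm]
    exact hs

/-- Entries of operators in `𝔅_k` vanish outside the words of length at most `k`. -/
theorem entry_eq_zero {k : ℕ} {T : FockSpace ι →L[ℂ] FockSpace ι} (hT : T ∈ supportedUpTo ι k)
    {μ ν : List ι} (h : ¬ (μ.length ≤ k ∧ ν.length ≤ k)) : entry T μ ν = 0 := by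
  rw [mem_supportedUpTo] at hT
  have hP : ⟪basisVec μ, proj ι k (T (proj ι k (basisVec ν)))⟫_ℂ =
      ⟪proj ι k (basisVec μ), T (proj ι k (basisVec ν))⟫_ℂ :=
    (Submodule.inner_starProjection_left_eq_right _ _ _).symm
  have he : entry T μ ν = ⟪proj ι k (basisVec μ), T (proj ι k (basisVec ν))⟫_ℂ := by
    rw [← hP, entry]
    conv_lhs => rw [← hT]
    rfl
  rw [he]
  by_cases hμ : μ.length ≤ k
  · rw [proj_basisVec_of_lt (not_le.1 fun hν => h ⟨hμ, hν⟩), map_zero, inner_zero_right]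
  · rw [proj_basisVec_of_lt (not_le.1 hμ), inner_zero_left]

/-- The finite double sum is the functional ∑ ⟨· u_κ, u_κ⟩ evaluated at the truncation of T, so
dominated convergence applies. -/
theorem tendsto_sum_entry_mul {ρ : StrongDual ℂ (ToeplitzCuntz ι)} {k : ℕ}
    {u : List ι → FockSpace ι} (hu : Summable fun κ => ‖u κ‖ ^ 2)
    (h : ∀ μ ν : List ι, μ.length ≤ k → ν.length ≤ k →
      HasSum (fun κ => ⟪u κ, basisVec μ⟫_ℂ * ⟪basisVec ν, u κ⟫_ℂ) (ρ (word μ * star (word ν))))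
    {T : FockSpace ι →L[ℂ] FockSpace ι} (hT : T ∈ supportedUpTo ι k) :
    Tendsto (fun s : Finset (List ι) => ∑ μ ∈ s, ∑ ν ∈ s,
      entry T μ ν * ρ (word μ * star (word ν))) atTop (𝓝 (∑' κ, ⟪u κ, T (u κ)⟫_ℂ)) := by
  refine (tendsto_tsum_inner_apply hu hu (norm_cutoff_conj_le T)
    (tendsto_inner_cutoff_conj T)).congr fun s => HasSum.tsum_eq ?_
  have hterm : ∀ μ ν, HasSum
      (fun κ => entry T μ ν * (⟪u κ, basisVec μ⟫_ℂ * ⟪basisVec ν, u κ⟫_ℂ))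
      (entry T μ ν * ρ (word μ * star (word ν))) := by
    intro μ ν
    by_cases hμν : μ.length ≤ k ∧ ν.length ≤ k
    · exact (h μ ν hμν.1 hμν.2).mul_left _
    · simp only [entry_eq_zero hT hμν, zero_mul]
      exact hasSum_zero
  have := hasSum_sum fun μ (_ : μ ∈ s) => hasSum_sum fun ν (_ : ν ∈ s) => hterm μ ν
  convert this using 2 with κ
  rw [mul_apply_eq_comp, mul_apply_eq_comp, cutoff_apply s (T _), inner_sum]
  refine Finset.sum_congr rfl fun μ _ => ?_
  rw [← inner_basisVec, cutoff_apply, map_sum, inner_sum, inner_smul_right, Finset.sum_mul]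
  refine Finset.sum_congr rfl fun ν _ => ?_
  rw [map_smul, inner_smul_right, inner_basisVec ν, entry]
  ring

/-- A positive functional `ρ` on the Toeplitz-Cuntz algebra gives rise to a locally normal decreasing
positive functional `ω` on `𝔅` with `ω(|v_μ⟩⟨v_ν|) = ρ(v_μ v_ν⋆)`. -/
theorem exists_locallyNormalCone_of_mem_positiveDual [Countable ι]
    {ρ : StrongDual ℂ (ToeplitzCuntz ι)} (hρ : ρ ∈ positiveDual (ToeplitzCuntz ι)) :
    ∃ ω ∈ locallyNormalCone ι, ∀ μ ν, ρ (word μ * star (word ν)) = ω (rankOneB μ ν) := by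
  choose u hu h using exists_summable_family hρ
  -- The matrix sums do not mention k or u, so their limit defines ω consistently on all the 𝔅_k at
  -- once.
  have hlim : ∀ B : boundedSupport ι, ∃ c, Tendsto (fun s : Finset (List ι) =>
      ∑ μ ∈ s, ∑ ν ∈ s, entry B.1 μ ν * ρ (word μ * star (word ν))) atTop (𝓝 c) := fun B =>
    B.2.elim fun k hk => ⟨_, tendsto_sum_entry_mul (hu k) (h k) hk⟩
  choose f hf using hlim
  let ω : boundedSupport ι →ₗ[ℂ] ℂ :=
    { toFun := f
      map_add' := fun B B' => by
        refine tendsto_nhds_unique (hf (B + B')) (((hf B).add (hf B')).congr fun s => ?_)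
        have : ∀ μ ν, entry (B + B').1 μ ν = entry B.1 μ ν + entry B'.1 μ ν := fun μ ν =>
          inner_add_right _ _ _
        simp only [this, add_mul, Finset.sum_add_distrib]
      map_smul' := fun c B => by
        refine tendsto_nhds_unique (hf (c • B)) (((hf B).const_mul c).congr fun s => ?_)
        have : ∀ μ ν, entry (c • B).1 μ ν = c * entry B.1 μ ν := fun μ ν =>
          inner_smul_right _ _ _
        simp only [this, Finset.mul_sum, mul_assoc] }
  have hωk : ∀ (k : ℕ) (B : boundedSupport ι),
      (B : FockSpace ι →L[ℂ] FockSpace ι) ∈ supportedUpTo ι k →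
      ω B = ∑' κ, ⟪u k κ, B.1 (u k κ)⟫_ℂ := fun k B hB =>
    tendsto_nhds_unique (hf B) (tendsto_sum_entry_mul (hu k) (h k) hB)
  have hnormal : IsLocallyNormal ω := fun k => by
    have hc := continuous_sigmaWeakTopology (hu k) (hu k)
    let _ := sigmaWeakTopology (FockSpace ι)
    let _ := levelTopology ι k
    have : (fun B : {B : boundedSupport ι // (B : FockSpace ι →L[ℂ] FockSpace ι) ∈
        supportedUpTo ι k} => ω B.1) = fun B => ∑' κ, ⟪u k κ, B.1.1 (u k κ)⟫_ℂ :=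
      funext fun B => hωk k B.1 B.2
    rw [this]
    exact hc.comp continuous_induced_dom
  have hword : ∀ μ ν, ρ (word μ * star (word ν)) = ω (rankOneB μ ν) := by
    intro μ ν
    obtain ⟨j, hj⟩ := (rankOneB μ ν).2
    -- Large enough for 𝔅_k to contain |v_μ⟩⟨v_ν| and for both words to have length at most k.
    let k := max j (max μ.length ν.length)
    rw [hωk k _ (supportedUpTo_mono ι (le_max_left _ _) hj),
      ← (h k μ ν (by omega) (by omega)).tsum_eq]
    refine tsum_congr fun κ => ?_
    change _ = ⟪u k κ, InnerProductSpace.rankOne ℂ (basisVec μ) (basisVec ν) (u k κ)⟫_ℂ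
    rw [InnerProductSpace.rankOne_apply, inner_smul_right, mul_comm]
  exact ⟨ω, ⟨hnormal.mem_decreasingCone (ρ := ρ) hρ hword, hnormal⟩, hword⟩

end FockSpace

end

/-! ### The order isomorphism -/

namespace FockSpace

open ToeplitzCuntz

variable {ι : Type}

/-- `ρ` is the functional on the Toeplitz-Cuntz algebra associated with `ω`. -/
theorem exists_positiveDual (ω : locallyNormalCone ι) :
    ∃ ρ : positiveDual (ToeplitzCuntz ι),
      ∀ μ ν : List ι, ρ.1 (word μ * star (word ν)) = ω.1 (rankOneB μ ν) :=
  let ⟨ρ, hρ, h⟩ := exists_positiveDual_of_mem_decreasingCone ω.2.1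
  ⟨⟨ρ, hρ⟩, h⟩

/-- The functional on the Toeplitz-Cuntz algebra associated with a locally normal decreasing positive
functional on `𝔅`. -/
noncomputable def toPositiveDual (ω : locallyNormalCone ι) : positiveDual (ToeplitzCuntz ι) :=
  (exists_positiveDual ω).choose

theorem toPositiveDual_apply (ω : locallyNormalCone ι) (μ ν : List ι) :
    (toPositiveDual ω).1 (word μ * star (word ν)) = ω.1 (rankOneB μ ν) :=
  (exists_positiveDual ω).choose_spec μ ν

variable (ι) in
/-- `toPositiveDual` as a linear map of cones. -/
noncomputable def toPositiveDualLinearMap :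
    locallyNormalCone ι →ₗ[{c : ℝ // 0 ≤ c}] positiveDual (ToeplitzCuntz ι) where
  toFun := toPositiveDual
  map_add' ω₁ ω₂ := Subtype.ext <| ext_word fun μ ν => by
    rw [toPositiveDual_apply]
    change _ = (toPositiveDual ω₁).1 (word μ * star (word ν)) +
      (toPositiveDual ω₂).1 (word μ * star (word ν))
    rw [toPositiveDual_apply, toPositiveDual_apply]
    rfl
  map_smul' c ω := Subtype.ext <| ext_word fun μ ν => by
    rw [toPositiveDual_apply]
    change _ = c • (toPositiveDual ω).1 (word μ * star (word ν))
    rw [toPositiveDual_apply]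
    rfl

theorem bijective_toPositiveDualLinearMap [Countable ι] :
    Function.Bijective (toPositiveDualLinearMap ι) := by
  refine ⟨fun ω₁ ω₂ h => Subtype.ext (ω₁.2.2.ext ω₂.2.2 fun μ ν => ?_), fun ρ => ?_⟩
  · rw [← toPositiveDual_apply, ← toPositiveDual_apply]
    exact congrArg (fun ρ => ρ.1 (word μ * star (word ν))) h
  · obtain ⟨ω, hω, h⟩ := exists_locallyNormalCone_of_mem_positiveDual ρ.2
    exact ⟨⟨ω, hω⟩, Subtype.ext <| ext_word fun μ ν =>
      (toPositiveDual_apply _ μ ν).trans (h μ ν).symm⟩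

/-- The two differences correspond on words. Forwards, the functional built from ω₂ - ω₁ must be ρ₂
- ρ₁ by density; backwards, ω₂ - ω₁ is again locally normal, so it inherits its properties from ρ₂ -
ρ₁. -/
theorem sub_mem_decreasingCone_iff (ω₁ ω₂ : locallyNormalCone ι) :
    ω₂.1 - ω₁.1 ∈ decreasingCone ι ↔
      (toPositiveDual ω₂).1 - (toPositiveDual ω₁).1 ∈ positiveDual (ToeplitzCuntz ι) := by
  have hsub : ∀ μ ν : List ι, ((toPositiveDual ω₂).1 - (toPositiveDual ω₁).1)
      (word μ * star (word ν)) = (ω₂.1 - ω₁.1) (rankOneB μ ν) := fun μ ν => by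
    rw [sub_apply, toPositiveDual_apply, toPositiveDual_apply]
    rfl
  constructor
  · intro h
    obtain ⟨ρ, hρ, hw⟩ := exists_positiveDual_of_mem_decreasingCone h
    rwa [ext_word fun μ ν => (hsub μ ν).trans (hw μ ν).symm]
  · intro h
    exact (ω₂.2.2.sub ω₁.2.2).mem_decreasingCone
      (ρ := ((toPositiveDual ω₂).1 - (toPositiveDual ω₁).1 : StrongDual ℂ (ToeplitzCuntz ι)))
      h hsub

theorem existsUnique_positiveFunctional {ω : boundedSupport ι →ₗ[ℂ] ℂ}
    (hω : ω ∈ decreasingCone ι) :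
    ∃! ρ : ToeplitzCuntz ι →ₗ[ℂ] ℂ, IsPositiveFunctional ρ ∧
      ∀ μ ν : List ι, ρ (word μ * star (word ν)) = ω (rankOneB μ ν) := by
  obtain ⟨ρ, hρ, h⟩ := exists_positiveDual_of_mem_decreasingCone hω
  refine ⟨ρ, ⟨hρ, h⟩, fun ρ' hρ' => ?_⟩
  have := ext_word (ρ₁ := ⟨ρ', continuous_of_isPositiveFunctional hρ'.1⟩) (ρ₂ := ρ)
    fun μ ν => (hρ'.2 μ ν).trans (h μ ν).symm
  exact congrArg ContinuousLinearMap.toLinearMap this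

end FockSpace

theorem mainTheorem1 (n : ℕ∞) (hn : 1 ≤ n) :
    (∀ ω ∈ FockSpace.locallyNormalCone (GeneratorIndex n),
      ∃! ρ : ToeplitzCuntz (GeneratorIndex n) →ₗ[ℂ] ℂ, IsPositiveFunctional ρ ∧
        ∀ μ ν : List (GeneratorIndex n),
          ρ (ToeplitzCuntz.word μ * star (ToeplitzCuntz.word ν)) = ω (FockSpace.rankOneB μ ν)) ∧
    ∃ Φ : FockSpace.locallyNormalCone (GeneratorIndex n) ≃ₗ[{c : ℝ // 0 ≤ c}]
        positiveDual (ToeplitzCuntz (GeneratorIndex n)),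
      (∀ ω, ∀ μ ν : List (GeneratorIndex n),
        (Φ ω).1 (ToeplitzCuntz.word μ * star (ToeplitzCuntz.word ν)) = ω.1 (FockSpace.rankOneB μ ν)) ∧
      ∀ ω₁ ω₂, ω₂.1 - ω₁.1 ∈ FockSpace.decreasingCone (GeneratorIndex n) ↔
        (Φ ω₂).1 - (Φ ω₁).1 ∈ positiveDual (ToeplitzCuntz (GeneratorIndex n)) := by
  refine ⟨fun ω hω => FockSpace.existsUnique_positiveFunctional hω.1,
    LinearEquiv.ofBijective _ FockSpace.bijective_toPositiveDualLinearMap,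
    FockSpace.toPositiveDual_apply, FockSpace.sub_mem_decreasingCone_iff⟩
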